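/- Let $R$ be an integral domain that is not a field and such that $R/(m)$ is finite for every $m\in R^\times:=R\setminus\{0\}$. Let $Q(R)$ be its field of fractions. Let $\mathfrak{A}[R]$ be the universal unital C*-algebra generated by isometries $s_m$ ($m\in R^\times$) and unitaries $u^n$ ($n\in R$) subject to the relations, for all $k,m\in R^\times$ and $l,n\in R$: $s_ks_m=s_{km}$, $u^lu^n=u^{l+n}$, $s_mu^n=u^{mn}s_m$, and $\sum_{n+(m)\in R/(m)}u^ne_mu^{-n}=1$, where $e_m=s_ms_m^*$. Let $P=\{u^ne_mu^{-n}: m\in R^\times,\ n\in R\}$ and let $\mathfrak{D}[R]=C^*(P)\subseteq\mathfrak{A}[R]$. Then $\mathfrak{D}[R]$ is commutative, and there is a faithful conditional expectation $\Theta:\mathfrak{A}[R]\to\mathfrak{D}[R]$ (that is, a positive linear contraction onto $\mathfrak{D}[R]$ which is the identity on $\mathfrak{D}[R]$, is a $\mathfrak{D}[R]$-bimodule map, and satisfies $\Theta(x^*x)=0\Rightarrow x=0$) such that $$\Theta(s_m^*u^nfu^{-n'}s_{m'})=\delta_{m,m'}\,\delta_{n,n'}\;s_m^*u^nfu^{-n}s_m\qquad(m,m'\in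 R^\times;\ n,n'\in R;\ f\in P).$$ It is characterized by this formula: every bounded linear map $\mathfrak{A}[R]\to\mathfrak{D}[R]$ that satisfies the formula equals $\Theta$. Moreover, $\Theta$ is the following double average. Let $\hat G$ and $\hat H$ be the compact Pontryagin duals of the discrete groups $G=(Q(R)^\times,\cdot)$ and $H=(R,+)$, with normalized Haar measures, and let $\mathfrak{B}=C^*(\{e_m: m\in R^\times\}\cup\{u^n: n\in R\})\subseteq\mathfrak{A}[R]$. There are point-norm continuous actions $\alpha$ of $\hat G$ on $\mathfrak{A}[R]$ and $\beta$ of $\hat H$ on $\mathfrak{B}$ by *-automorphisms with $\alpha_\phi(s_m)=\phi(m)s_m$, $\alpha_\phi(u^n)=u^n$, $\beta_\chi(e_m)=e_m$, $\beta_\chi(u^n)=\chi(n)u^n$, and for every $x\in\mathfrak{A}[R]$ one has $$\int_{\hat G}\alpha_\phi(x)\,d\phi\in\mathfrak{B},\qquad \Theta(x)=\int_{\hat H}\beta_\chi\Big(\int_{\hat G}\alpha_\phi(x)\,d\phi\Big)d\chi .$$ -/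

import Mathlib

open scoped nonZeroDivisors

noncomputable section

namespace RingCStar

/-! ### The free unital complex *-algebra on a set of generators -/

/-- The free unital complex `*`-algebra on `X`: the monoid algebra of the words in the letters
`(x, false)`, standing for `x`, and `(x, true)`, standing for `x^*`. -/
abbrev FreeStarAlg (X : Type*) : Type _ := MonoidAlgebra ℂ (FreeMonoid (X × Bool))

namespace FreeStarAlg

variable {X : Type*}

/-- The letter `x` (for `b = false`) or `x^*` (for `b = true`). -/
def letter (x : X) (b : Bool) : FreeStarAlg X :=
  MonoidAlgebra.of ℂ (FreeMonoid (X × Bool)) (FreeMonoid.of (x, b))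

/-- The generator `x`. -/
def gen (x : X) : FreeStarAlg X := letter x false

theorem induction_on {P : FreeStarAlg X → Prop} (a : FreeStarAlg X)
    (h_scalar : ∀ c : ℂ, P (algebraMap ℂ _ c)) (h_letter : ∀ x b, P (letter x b))
    (h_add : ∀ a b, P a → P b → P (a + b)) (h_mul : ∀ a b, P a → P b → P (a * b)) : P a := by
  have h_one : P 1 := by rw [← map_one (algebraMap ℂ (FreeStarAlg X))]; exact h_scalar 1
  have h_word : ∀ w : FreeMonoid (X × Bool), P (MonoidAlgebra.of ℂ _ w : MonoidAlgebra ℂ _) := by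
    intro w
    induction w using FreeMonoid.inductionOn' with
    | one => rw [map_one]; exact h_one
    | of_mul x w ih => rw [map_mul]; exact h_mul _ _ (h_letter x.1 x.2) ih
  refine MonoidAlgebra.induction_on (motive := P) a h_word h_add ?_
  intro c f hf
  have := h_mul _ _ (h_scalar c) hf
  rwa [← Algebra.smul_def] at this

/-- The conjugate-linear ring homomorphism to the opposite algebra that exchanges `x` and `x^*`. -/
def starHom : FreeStarAlg X →+* (FreeStarAlg X)ᵐᵒᵖ :=
  MonoidAlgebra.liftNCRingHom
    ((algebraMap ℂ (FreeStarAlg X)ᵐᵒᵖ).comp (starRingEnd ℂ))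
    (FreeMonoid.lift fun p : X × Bool => MulOpposite.op (letter p.1 (!p.2)))
    (fun c _ => Algebra.commute_algebraMap_left (starRingEnd ℂ c) _)

theorem starHom_algebraMap (c : ℂ) :
    starHom (algebraMap ℂ (FreeStarAlg X) c) = algebraMap ℂ _ (starRingEnd ℂ c) := by
  have h : (algebraMap ℂ (FreeStarAlg X) c) = MonoidAlgebra.single 1 c := rfl
  rw [h, starHom]
  rw [MonoidAlgebra.liftNCRingHom_single]
  simp

theorem starHom_letter (x : X) (b : Bool) :
    starHom (letter x b) = MulOpposite.op (letter x (!b)) := by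
  rw [starHom, letter, MonoidAlgebra.of_apply, MonoidAlgebra.liftNCRingHom_single, map_one,
    one_mul, FreeMonoid.lift_eval_of]

instance : StarRing (FreeStarAlg X) where
  star a := (starHom a).unop
  star_involutive a := by
    induction a using induction_on with
    | h_scalar c =>
      beta_reduce
      rw [starHom_algebraMap, MulOpposite.algebraMap_apply, MulOpposite.unop_op,
        starHom_algebraMap, MulOpposite.algebraMap_apply, MulOpposite.unop_op, Complex.conj_conj]
    | h_letter x b =>
      beta_reduce
      rw [starHom_letter, MulOpposite.unop_op, starHom_letter, MulOpposite.unop_op, Bool.not_not]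
    | h_add a b ha hb => simp only [map_add, MulOpposite.unop_add, ha, hb]
    | h_mul a b ha hb => simp only [map_mul, MulOpposite.unop_mul, ha, hb]
  star_mul a b := by simp only [map_mul, MulOpposite.unop_mul]
  star_add a b := by simp only [map_add, MulOpposite.unop_add]

theorem star_def (a : FreeStarAlg X) : star a = (starHom a).unop := rfl

theorem star_letter (x : X) (b : Bool) : star (letter x b) = letter x (!b) := by
  rw [star_def, starHom_letter, MulOpposite.unop_op]

theorem star_algebraMap (c : ℂ) :
    star (algebraMap ℂ (FreeStarAlg X) c) = algebraMap ℂ _ (star c) := by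
  rw [star_def, starHom_algebraMap, MulOpposite.algebraMap_apply, MulOpposite.unop_op]; rfl

instance : StarModule ℂ (FreeStarAlg X) where
  star_smul c a := by
    rw [Algebra.smul_def, star_mul, star_algebraMap, Algebra.smul_def, Algebra.commutes]

end FreeStarAlg

/-! ### The defining relations -/

/-- The defining relations of `𝔄[R]`, for families `s` (indexed by the nonzero elements) and `u`
(indexed by all elements of `R`) in a unital `*`-ring: `Rel s u x y` says that `x = y` is one of
the required equations. In `partition` one representative is picked in each coset of `(m)`. -/
inductive Rel {R : Type*} [CommRing R] {B : Type*} [Ring B] [StarRing B]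
    (s : R⁰ → B) (u : R → B) : B → B → Prop
  | isometry (m : R⁰) : Rel s u (star (s m) * s m) 1
  | unitary_left (n : R) : Rel s u (star (u n) * u n) 1
  | unitary_right (n : R) : Rel s u (u n * star (u n)) 1
  | mul (k m : R⁰) : Rel s u (s k * s m) (s (k * m))
  | add (l n : R) : Rel s u (u l * u n) (u (l + n))
  | comm (m : R⁰) (n : R) : Rel s u (s m * u n) (u (m * n) * s m)
  | partition (m : R⁰) : Rel s u
      (∑ᶠ c : R ⧸ Ideal.span {(m : R)},
        u (Quotient.out c) * (s m * star (s m)) * u (-Quotient.out c)) 1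

/-- The families `s`, `u` satisfy all the defining relations. -/
def Satisfies {R : Type*} [CommRing R] {B : Type*} [Ring B] [StarRing B]
    (s : R⁰ → B) (u : R → B) : Prop :=
  ∀ x y, Rel s u x y → x = y

/-! ### The universal C*-algebra -/

/-- `p` is a C*-seminorm on the unital complex `*`-algebra `F`. -/
structure IsCStarSeminorm {F : Type*} [Ring F] [StarRing F] [Algebra ℂ F] (p : F → ℝ) : Prop where
  add_le : ∀ x y, p (x + y) ≤ p x + p y
  smul : ∀ (c : ℂ) x, p (c • x) = ‖c‖ * p x
  mul_le : ∀ x y, p (x * y) ≤ p x * p y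
  star_mul_self : ∀ x, p (star x * x) = p x ^ 2

section IsCStarSeminorm

variable {F : Type*} [Ring F] [StarRing F] [Algebra ℂ F] {p : F → ℝ}

theorem IsCStarSeminorm.zero (h : IsCStarSeminorm p) : p 0 = 0 := by
  simpa using h.smul 0 0

theorem IsCStarSeminorm.neg (h : IsCStarSeminorm p) (x : F) : p (-x) = p x := by
  simpa using h.smul (-1) x

theorem IsCStarSeminorm.nonneg (h : IsCStarSeminorm p) (x : F) : 0 ≤ p x := by
  have := h.add_le x (-x)
  rw [add_neg_cancel, h.zero, h.neg] at this
  linarith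

theorem IsCStarSeminorm.le_star (h : IsCStarSeminorm p) (x : F) : p x ≤ p (star x) := by
  by_contra hc
  push Not at hc
  have h0 := h.nonneg (star x)
  have h1 := h.mul_le (star x) x
  rw [h.star_mul_self] at h1
  nlinarith

theorem IsCStarSeminorm.map_star (h : IsCStarSeminorm p) (x : F) : p (star x) = p x :=
  le_antisymm (by simpa using h.le_star (star x)) (h.le_star x)

theorem IsCStarSeminorm.le_one_of_sq (h : IsCStarSeminorm p) {x : F}
    (hx : p (star x * x) ≤ 1) : p x ≤ 1 := by
  rw [h.star_mul_self] at hx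
  nlinarith

theorem IsCStarSeminorm.one_le (h : IsCStarSeminorm p) : p 1 ≤ 1 := by
  have h1 := h.star_mul_self 1
  rw [star_one, one_mul] at h1
  by_contra hc
  push Not at hc
  nlinarith

end IsCStarSeminorm

section Universal

variable (R : Type*) [CommRing R]

/-- The free `*`-algebra on symbols `s_m` (`m` nonzero) and `u^n` (`n : R`). -/
abbrev Pre : Type _ := FreeStarAlg (R⁰ ⊕ R)

variable {R}

/-- The symbol `s_m`. -/
def preS (m : R⁰) : Pre R := FreeStarAlg.gen (Sum.inl m)

/-- The symbol `u^n`. -/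
def preU (n : R) : Pre R := FreeStarAlg.gen (Sum.inr n)

variable (R)

/-- The C*-seminorms on the free `*`-algebra for which the defining relations hold. -/
def Admissible : Type _ :=
  {p : Pre R → ℝ // IsCStarSeminorm p ∧ ∀ x y, Rel preS preU x y → p (x - y) = 0}

instance : Nonempty (Admissible R) :=
  ⟨⟨fun _ => 0, ⟨by simp, by simp, by simp, by simp⟩, by simp⟩⟩

variable {R}

theorem Admissible.le_one_letter (p : Admissible R) (x : R⁰ ⊕ R) (b : Bool) :
    p.1 (FreeStarAlg.letter x b) ≤ 1 := by
  have key : ∀ a : Pre R, Rel preS preU (star a * a) 1 → p.1 a ≤ 1 := by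
    intro a ha
    refine p.2.1.le_one_of_sq ?_
    have h1 := p.2.2 _ _ ha
    have h2 := p.2.1.add_le (star a * a - 1) 1
    rw [sub_add_cancel, h1, zero_add] at h2
    exact h2.trans p.2.1.one_le
  have hgen : p.1 (FreeStarAlg.gen x) ≤ 1 := by
    rcases x with m | n
    · exact key _ (Rel.isometry m)
    · exact key _ (Rel.unitary_left n)
  cases b with
  | false => exact hgen
  | true =>
    have : FreeStarAlg.letter x true = star (FreeStarAlg.gen x) := by
      rw [FreeStarAlg.gen, FreeStarAlg.star_letter]; rfl
    rw [this, p.2.1.map_star]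
    exact hgen

theorem exists_bound (a : Pre R) : ∃ C : ℝ, ∀ p : Admissible R, p.1 a ≤ C := by
  induction a using FreeStarAlg.induction_on with
  | h_scalar c =>
    refine ⟨‖c‖, fun p => ?_⟩
    rw [Algebra.algebraMap_eq_smul_one, p.2.1.smul]
    exact mul_le_of_le_one_right (norm_nonneg _) p.2.1.one_le
  | h_letter x b => exact ⟨1, fun p => p.le_one_letter x b⟩
  | h_add a b ha hb =>
    obtain ⟨C, hC⟩ := ha
    obtain ⟨D, hD⟩ := hb
    exact ⟨C + D, fun p => (p.2.1.add_le a b).trans (add_le_add (hC p) (hD p))⟩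
  | h_mul a b ha hb =>
    obtain ⟨C, hC⟩ := ha
    obtain ⟨D, hD⟩ := hb
    exact ⟨C * D, fun p => (p.2.1.mul_le a b).trans
      (mul_le_mul (hC p) (hD p) (p.2.1.nonneg b) ((p.2.1.nonneg a).trans (hC p)))⟩

/-- The largest C*-seminorm on the free `*`-algebra for which the defining relations hold. -/
def univNorm (a : Pre R) : ℝ := ⨆ p : Admissible R, p.1 a

theorem le_univNorm (p : Admissible R) (a : Pre R) : p.1 a ≤ univNorm a := by
  obtain ⟨C, hC⟩ := exists_bound a
  exact le_ciSup (f := fun p : Admissible R => p.1 a) ⟨C, by rintro _ ⟨q, rfl⟩; exact hC q⟩ p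

theorem univNorm_le {a : Pre R} {C : ℝ} (h : ∀ p : Admissible R, p.1 a ≤ C) : univNorm a ≤ C :=
  ciSup_le h

theorem univNorm_nonneg (a : Pre R) : 0 ≤ univNorm a :=
  ((Classical.arbitrary (Admissible R)).2.1.nonneg a).trans (le_univNorm _ a)

theorem isCStarSeminorm_univNorm : IsCStarSeminorm (univNorm (R := R)) where
  add_le x y := univNorm_le fun p =>
    (p.2.1.add_le x y).trans (add_le_add (le_univNorm p x) (le_univNorm p y))
  smul c x := by
    unfold univNorm
    rw [Real.mul_iSup_of_nonneg (norm_nonneg c)]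
    exact iSup_congr fun p => p.2.1.smul c x
  mul_le x y := univNorm_le fun p => (p.2.1.mul_le x y).trans
    (mul_le_mul (le_univNorm p x) (le_univNorm p y) (p.2.1.nonneg y) (univNorm_nonneg x))
  star_mul_self x := by
    refine le_antisymm (univNorm_le fun p => ?_) ?_
    · rw [p.2.1.star_mul_self]
      exact pow_le_pow_left₀ (p.2.1.nonneg x) (le_univNorm p x) 2
    · have h : univNorm x ≤ √(univNorm (star x * x)) := univNorm_le fun p => by
        apply Real.le_sqrt_of_sq_le
        rw [← p.2.1.star_mul_self]
        exact le_univNorm p _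
      calc univNorm x ^ 2 ≤ √(univNorm (star x * x)) ^ 2 :=
            pow_le_pow_left₀ (univNorm_nonneg x) h 2
        _ = _ := Real.sq_sqrt (univNorm_nonneg _)

theorem univNorm_rel {x y : Pre R} (h : Rel preS preU x y) : univNorm (x - y) = 0 :=
  le_antisymm (univNorm_le fun p => (p.2.2 x y h).le) (univNorm_nonneg _)

instance : SeminormedRing (Pre R) where
  norm := univNorm
  dist x y := univNorm (-x + y)
  dist_self x := by simpa using isCStarSeminorm_univNorm.zero
  dist_comm x y := by
    rw [← isCStarSeminorm_univNorm.neg]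
    congr 1
    abel
  dist_triangle x y z := by
    have := isCStarSeminorm_univNorm.add_le (-x + y) (-y + z)
    rwa [show -x + y + (-y + z) = -x + z by abel] at this
  dist_eq _ _ := rfl
  norm_mul_le := isCStarSeminorm_univNorm.mul_le

theorem norm_def (a : Pre R) : ‖a‖ = univNorm a := rfl

instance : NormedAlgebra ℂ (Pre R) where
  norm_smul_le c x := (isCStarSeminorm_univNorm.smul c x).le

variable (R)

/-- The universal C*-algebra `𝔄[R]`: the Hausdorff completion of the free `*`-algebra with respect
to its largest C*-seminorm that respects the defining relations. -/
def Alg : Type _ := UniformSpace.Completion (Pre R)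

variable {R}

instance : NormedRing (Alg R) := inferInstanceAs (NormedRing (UniformSpace.Completion (Pre R)))

instance : CompleteSpace (Alg R) :=
  inferInstanceAs (CompleteSpace (UniformSpace.Completion (Pre R)))

instance : Algebra ℂ (Alg R) := inferInstanceAs (Algebra ℂ (UniformSpace.Completion (Pre R)))

instance : NormedAlgebra ℂ (Alg R) where
  norm_smul_le c x := norm_smul_le c (show UniformSpace.Completion (Pre R) from x)

/-- The canonical map from the free `*`-algebra. -/
def ofPre : Pre R →+* Alg R := UniformSpace.Completion.coeRingHom

theorem norm_ofPre (a : Pre R) : ‖ofPre a‖ = ‖a‖ := UniformSpace.Completion.norm_coe a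

theorem ofPre_smul (c : ℂ) (a : Pre R) : ofPre (c • a) = c • ofPre a :=
  UniformSpace.Completion.coe_smul c a

theorem denseRange_ofPre : DenseRange (ofPre (R := R)) :=
  UniformSpace.Completion.denseRange_coe

theorem uniformContinuous_star_pre : UniformContinuous (star : Pre R → Pre R) := by
  refine (AddMonoidHomClass.isometry_of_norm (starAddEquiv : Pre R ≃+ Pre R) ?_).uniformContinuous
  exact fun x => isCStarSeminorm_univNorm.map_star x

instance : Star (Alg R) := ⟨UniformSpace.Completion.map star⟩

theorem star_ofPre (a : Pre R) : star (ofPre a) = ofPre (star a) :=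
  UniformSpace.Completion.map_coe uniformContinuous_star_pre a

theorem continuous_star_alg : Continuous (star : Alg R → Alg R) :=
  UniformSpace.Completion.continuous_map

theorem alg_induction {P : Alg R → Prop} (hc : IsClosed {x | P x}) (h : ∀ a, P (ofPre a))
    (x : Alg R) : P x :=
  UniformSpace.Completion.induction_on x hc h

instance : StarRing (Alg R) where
  star_involutive x := by
    refine alg_induction (P := fun x => star (star x) = x) ?_ ?_ x
    · exact isClosed_eq (continuous_star_alg.comp continuous_star_alg) continuous_id
    · intro a; rw [star_ofPre, star_ofPre, star_star]
  star_mul x y := by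
    have hs := continuous_star_alg (R := R)
    refine alg_induction (P := fun x => star (x * y) = star y * star x) ?_ ?_ x
    · exact isClosed_eq (by fun_prop) (by fun_prop)
    intro a
    refine alg_induction (P := fun y => star (ofPre a * y) = star y * star (ofPre a)) ?_ ?_ y
    · exact isClosed_eq (by fun_prop) (by fun_prop)
    intro b
    rw [← map_mul, star_ofPre, star_ofPre, star_ofPre, star_mul, map_mul]
  star_add x y := by
    have hs := continuous_star_alg (R := R)
    refine alg_induction (P := fun x => star (x + y) = star x + star y) ?_ ?_ x
    · exact isClosed_eq (by fun_prop) (by fun_prop)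
    intro a
    refine alg_induction (P := fun y => star (ofPre a + y) = star (ofPre a) + star y) ?_ ?_ y
    · exact isClosed_eq (by fun_prop) (by fun_prop)
    intro b
    rw [← map_add, star_ofPre, star_ofPre, star_ofPre, star_add, map_add]

instance : CStarAlgebra (Alg R) where
  norm_mul_self_le x := by
    have hs := continuous_star_alg (R := R)
    refine alg_induction (P := fun x => ‖x‖ * ‖x‖ ≤ ‖star x * x‖) ?_ ?_ x
    · exact isClosed_le (by fun_prop) (by fun_prop)
    intro a
    rw [star_ofPre, ← map_mul, norm_ofPre, norm_ofPre, norm_def, norm_def,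
      isCStarSeminorm_univNorm.star_mul_self, sq]
  star_smul c x := by
    have hs := continuous_star_alg (R := R)
    refine alg_induction (P := fun x => star (c • x) = star c • star x) ?_ ?_ x
    · exact isClosed_eq (hs.comp (continuous_const_smul c)) (hs.const_smul (star c))
    intro a
    rw [← ofPre_smul, star_ofPre, star_ofPre, star_smul, ofPre_smul]

/-- The isometry `s_m` in `𝔄[R]`. -/
def s (m : R⁰) : Alg R := ofPre (preS m)

/-- The unitary `u^n` in `𝔄[R]`. -/
def u (n : R) : Alg R := ofPre (preU n)

/-- The range projection `e_m = s_m s_m^*`. -/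
def e (m : R⁰) : Alg R := s m * star (s m)

/-- Ring homomorphisms that respect the involution preserve the defining relations. -/
theorem Rel.map {B C : Type*} [Ring B] [StarRing B] [Ring C] [StarRing C]
    (hfin : ∀ m : R, m ≠ 0 → Finite (R ⧸ Ideal.span {m})) (f : B →+* C)
    (hf : ∀ b, f (star b) = star (f b)) {s' : R⁰ → B} {u' : R → B} [Nontrivial R] {x y : B}
    (h : Rel s' u' x y) : Rel (fun m => f (s' m)) (fun n => f (u' n)) (f x) (f y) := by
  cases h with
  | isometry m => rw [map_mul, hf, map_one]; exact .isometry (s := fun m => f (s' m)) m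
  | unitary_left n => rw [map_mul, hf, map_one]; exact .unitary_left (u := fun m => f (u' m)) n
  | unitary_right n => rw [map_mul, hf, map_one]; exact .unitary_right (u := fun m => f (u' m)) n
  | mul k m => rw [map_mul]; exact .mul (s := fun m => f (s' m)) k m
  | add l n => rw [map_mul]; exact .add (u := fun m => f (u' m)) l n
  | comm m n =>
    rw [map_mul, map_mul]
    exact .comm (s := fun m => f (s' m)) (u := fun m => f (u' m)) m n
  | partition m =>
    have := hfin m (nonZeroDivisors.coe_ne_zero m)
    have h := Rel.partition (s := fun m => f (s' m)) (u := fun m => f (u' m)) m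
    rw [map_one]
    convert h using 1
    have h2 := AddMonoidHom.map_finsum (f : B →+ C)
      (Set.toFinite (Function.support fun c : R ⧸ Ideal.span {(m : R)} =>
        u' (Quotient.out c) * (s' m * star (s' m)) * u' (-Quotient.out c)))
    refine h2.trans (finsum_congr fun c => ?_)
    simp [hf]

/-- The generators of `𝔄[R]` satisfy the defining relations. -/
theorem satisfies_generators [Nontrivial R]
    (hfin : ∀ m : R, m ≠ 0 → Finite (R ⧸ Ideal.span {m})) :
    Satisfies (s (R := R)) (u (R := R)) := by
  have key : ∀ x y : Pre R, Rel preS preU x y → ofPre x = ofPre y := by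
    intro x y h
    rw [← sub_eq_zero, ← map_sub, ← norm_eq_zero, norm_ofPre]
    exact univNorm_rel h
  have hs : ∀ a : Pre R, star (ofPre a) = ofPre (star a) := star_ofPre
  intro x y h
  cases h with
  | isometry m => simpa [hs, s] using key _ _ (.isometry m)
  | unitary_left n => simpa [hs, u] using key _ _ (.unitary_left n)
  | unitary_right n => simpa [hs, u] using key _ _ (.unitary_right n)
  | mul k m => simpa [hs, s] using key _ _ (.mul k m)
  | add l n => simpa [hs, u] using key _ _ (.add l n)
  | comm m n => simpa [hs, s, u] using key _ _ (.comm m n)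
  | partition m =>
    have := hfin m (nonZeroDivisors.coe_ne_zero m)
    have h1 := key _ _ (.partition m)
    rw [map_one] at h1
    rw [← h1]
    have h2 := AddMonoidHom.map_finsum (ofPre : Pre R →+* Alg R).toAddMonoidHom
      (Set.toFinite (Function.support fun c : R ⧸ Ideal.span {(m : R)} =>
        preU (Quotient.out c) * (preS m * star (preS m)) * preU (-Quotient.out c)))
    refine ((h2.trans (finsum_congr fun c => ?_))).symm
    simp [hs, s, u]

/-- Evaluation of the free `*`-algebra at elements of a C*-algebra. -/
def evalPre {B : Type*} [CStarAlgebra B] (s' : R⁰ → B) (u' : R → B) : Pre R →ₐ[ℂ] B :=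
  MonoidAlgebra.lift ℂ B _ (FreeMonoid.lift fun q : (R⁰ ⊕ R) × Bool =>
    if q.2 then star (Sum.elim s' u' q.1) else Sum.elim s' u' q.1)

theorem evalPre_letter {B : Type*} [CStarAlgebra B] (s' : R⁰ → B) (u' : R → B)
    (x : R⁰ ⊕ R) (b : Bool) : evalPre s' u' (FreeStarAlg.letter x b) =
      if b then star (Sum.elim s' u' x) else Sum.elim s' u' x := by
  rw [evalPre, FreeStarAlg.letter, MonoidAlgebra.lift_of, FreeMonoid.lift_eval_of]

theorem evalPre_star {B : Type*} [CStarAlgebra B] (s' : R⁰ → B) (u' : R → B) (a : Pre R) :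
    evalPre s' u' (star a) = star (evalPre s' u' a) := by
  induction a using FreeStarAlg.induction_on with
  | h_scalar c =>
    rw [FreeStarAlg.star_algebraMap, AlgHom.commutes, AlgHom.commutes, algebraMap_star_comm]
  | h_letter x b => rw [FreeStarAlg.star_letter, evalPre_letter, evalPre_letter]; cases b <;> simp
  | h_add a b ha hb => rw [star_add, map_add, map_add, star_add, ha, hb]
  | h_mul a b ha hb => rw [star_mul, map_mul, map_mul, star_mul, ha, hb]

open scoped CStarAlgebra in
/-- The universal property of `𝔄[R]`, for C*-algebras in every universe. -/
theorem existsUnique_lift [Nontrivial R] (hfin : ∀ m : R, m ≠ 0 → Finite (R ⧸ Ideal.span {m}))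
    {B : Type*} [CStarAlgebra B] (s' : R⁰ → B) (u' : R → B) (h : Satisfies s' u') :
    ∃! π : Alg R →⋆ₐ[ℂ] B, (∀ m, π (s m) = s' m) ∧ ∀ n, π (u n) = u' n := by
  set ev := evalPre s' u' with hev
  have evS : ∀ m, ev (preS m) = s' m := fun m => by
    rw [hev, preS, FreeStarAlg.gen, evalPre_letter]; simp
  have evU : ∀ m, ev (preU m) = u' m := fun m => by
    rw [hev, preU, FreeStarAlg.gen, evalPre_letter]; simp
  have hstar : ∀ a, ev (star a) = star (ev a) := evalPre_star s' u'
  let p : Admissible R := ⟨fun a => ‖ev a‖,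
    ⟨fun x y => by rw [map_add]; exact norm_add_le _ _,
      fun c x => by rw [map_smul, norm_smul],
      fun x y => by rw [map_mul]; exact norm_mul_le _ _,
      fun x => by rw [map_mul, hstar, CStarRing.norm_star_mul_self, sq]⟩, by
    intro x y hxy
    have h1 := Rel.map hfin (ev : Pre R →+* B) hstar hxy
    have h2 : ev x = ev y := by
      apply h
      convert h1 using 1
      · funext m; exact (evS m).symm
      · funext m; exact (evU m).symm
      · rfl
      · rfl
    beta_reduce
    rw [map_sub, h2, sub_self, norm_zero]⟩
  have hle : ∀ a, ‖ev a‖ ≤ ‖a‖ := fun a => le_univNorm p a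
  have hcont : Continuous (ev : Pre R →+* B) :=
    AddMonoidHomClass.continuous_of_bound (ev : Pre R →+* B) 1 fun a => by
      rw [one_mul]; exact hle a
  let f : Alg R →+* B := UniformSpace.Completion.extensionHom (ev : Pre R →+* B) hcont
  have hf : ∀ a, f (ofPre a) = ev a := fun a =>
    UniformSpace.Completion.extensionHom_coe (ev : Pre R →+* B) hcont a
  have hfc : Continuous f := UniformSpace.Completion.continuous_extension
  have hsc := continuous_star_alg (R := R)
  have hsmul : ∀ (c : ℂ) x, f (c • x) = c • f x := fun c x => by
    refine alg_induction (P := fun x => f (c • x) = c • f x) ?_ ?_ x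
    · exact isClosed_eq (hfc.comp (continuous_const_smul c)) (hfc.const_smul c)
    · intro a; rw [← ofPre_smul, hf, hf, map_smul]
  have hfstar : ∀ x, f (star x) = star (f x) := fun x => by
    refine alg_induction (P := fun x => f (star x) = star (f x)) ?_ ?_ x
    · exact isClosed_eq (hfc.comp hsc) (continuous_star.comp hfc)
    · intro a; rw [star_ofPre, hf, hf, hstar]
  let π : Alg R →⋆ₐ[ℂ] B :=
    { f with
      commutes' := fun c => by
        change f (algebraMap ℂ _ c) = _
        rw [Algebra.algebraMap_eq_smul_one, hsmul, map_one, Algebra.algebraMap_eq_smul_one]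
      map_star' := hfstar }
  refine ⟨π, ⟨fun m => (hf _).trans (evS m), fun n => (hf _).trans (evU n)⟩, ?_⟩
  rintro ρ ⟨hρs, hρu⟩
  have hρc : Continuous ρ := map_continuous ρ
  have hpre : ∀ a, ρ (ofPre a) = f (ofPre a) := by
    intro a
    have hgen : ∀ x, ρ (ofPre (FreeStarAlg.gen x)) = f (ofPre (FreeStarAlg.gen x)) := by
      rintro (m | n)
      · exact (hρs m).trans ((hf _).trans (evS m)).symm
      · exact (hρu n).trans ((hf _).trans (evU n)).symm
    induction a using FreeStarAlg.induction_on with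
    | h_scalar c =>
      rw [Algebra.algebraMap_eq_smul_one, ofPre_smul, map_smul, hsmul, map_one, map_one, map_one]
    | h_letter x b =>
      cases b with
      | false => exact hgen x
      | true =>
        have : FreeStarAlg.letter x true = star (FreeStarAlg.gen x) := by
          rw [FreeStarAlg.gen, FreeStarAlg.star_letter]; rfl
        rw [this, ← star_ofPre, map_star, hfstar, hgen]
    | h_add a b ha hb => rw [map_add, map_add, map_add, ha, hb]
    | h_mul a b ha hb => rw [map_mul, map_mul, map_mul, ha, hb]
  ext x
  exact alg_induction (P := fun x => ρ x = f x) (isClosed_eq hρc hfc) hpre x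

variable (R)

/-! ### The commutative subalgebra `𝔇[R]` and conditional expectations -/

/-- The set `P` of the projections `u^n e_m u^{-n}`. -/
def projSet : Set (Alg R) := {f | ∃ (m : R⁰) (n : R), f = u n * e m * u (-n)}

/-- `𝔇[R] = C^*(P)`. -/
def diagAlg : StarSubalgebra ℂ (Alg R) := (StarAlgebra.adjoin ℂ (projSet R)).topologicalClosure

end Universal

/-- `Θ` is a conditional expectation of the C*-algebra `A` onto its subalgebra `D`: a positive
contraction with values in `D` that is the identity on `D` and a `D`-bimodule map. -/
structure IsCondExp {A : Type*} [CStarAlgebra A] (D : StarSubalgebra ℂ A) (Θ : A →L[ℂ] D) :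
    Prop where
  contractive : ∀ x, ‖Θ x‖ ≤ ‖x‖
  positive : ∀ x : A, ∃ y : D, Θ (star x * x) = star y * y
  apply_coe : ∀ d : D, Θ d = d
  left_mul : ∀ (d : D) (x : A), Θ (d * x) = d * Θ x
  right_mul : ∀ (x : A) (d : D), Θ (x * d) = Θ x * d

/-- `Θ` is faithful: it vanishes on no nonzero positive element. -/
def IsFaithful {A : Type*} [CStarAlgebra A] {D : StarSubalgebra ℂ A} (Θ : A →L[ℂ] D) : Prop :=
  ∀ x : A, Θ (star x * x) = 0 → x = 0

open Classical in
/-- The Kronecker symbol. -/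
def delta {ι : Type*} (i j : ι) : ℂ := if i = j then 1 else 0

/-- `Θ(s_m^* u^n f u^{-n'} s_{m'}) = δ_{m,m'} δ_{n,n'} s_m^* u^n f u^{-n} s_m`. -/
def StandardFormula {R : Type*} [CommRing R] (Θ : Alg R →L[ℂ] diagAlg R) : Prop :=
  ∀ (m m' : R⁰) (n n' : R), ∀ f ∈ projSet R,
    (Θ (star (s m) * u n * f * u (-n') * s m') : Alg R) =
      (delta m m' * delta n n') • (star (s m) * u n * f * u (-n) * s m)

/-! ### Dual groups and averages -/

/-- The group `G` with the discrete topology. -/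
def Disc (G : Type*) : Type _ := G

instance {G : Type*} [CommGroup G] : CommGroup (Disc G) := inferInstanceAs (CommGroup G)

instance {G : Type*} : TopologicalSpace (Disc G) := ⊥

instance {G : Type*} : DiscreteTopology (Disc G) := ⟨rfl⟩

/-- The (compact) Pontryagin dual of the discrete abelian group `G`. -/
abbrev Dual (G : Type*) [CommGroup G] : Type _ := PontryaginDual (Disc G)

instance {G : Type*} [CommGroup G] : MeasurableSpace (Dual G) := borel _

instance {G : Type*} [CommGroup G] : BorelSpace (Dual G) := ⟨rfl⟩

/-- The value of a character. -/
def Dual.val {G : Type*} [CommGroup G] (χ : Dual G) (g : G) : ℂ := (χ (show Disc G from g) : Circle)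

/-- The normalized Haar measure on the dual group. -/
def dualHaar (G : Type*) [CommGroup G] : MeasureTheory.Measure (Dual G) :=
  MeasureTheory.Measure.haarMeasure ⊤

section Averages

variable (R : Type*) [CommRing R]

/-- `C^*({e_m} ∪ {u^n})`. -/
def coreAlg : StarSubalgebra ℂ (Alg R) :=
  (StarAlgebra.adjoin ℂ (Set.range (e (R := R)) ∪ Set.range (u (R := R)))).topologicalClosure

variable {R}

/-- `e_m` as an element of `C^*({e_m} ∪ {u^n})`. -/
def coreE (m : R⁰) : coreAlg R :=
  ⟨e m, StarSubalgebra.le_topologicalClosure _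
    (StarAlgebra.subset_adjoin ℂ _ (Or.inl ⟨m, rfl⟩))⟩

/-- `u^n` as an element of `C^*({e_m} ∪ {u^n})`. -/
def coreU (n : R) : coreAlg R :=
  ⟨u n, StarSubalgebra.le_topologicalClosure _
    (StarAlgebra.subset_adjoin ℂ _ (Or.inr ⟨n, rfl⟩))⟩

/-- A nonzero element of `R` as an element of the multiplicative group of the fraction field. -/
def toFrac (m : R⁰) : (FractionRing R)ˣ := (IsLocalization.map_units (FractionRing R) m).unit

/-- `α` is the point-norm continuous action of the dual of `Q(R)^×` on `𝔄[R]` with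
`α_φ(s_m) = φ(m) s_m` and `α_φ(u^n) = u^n`. -/
structure IsMulDualAction (α : Dual (FractionRing R)ˣ →* (Alg R ≃⋆ₐ[ℂ] Alg R)) : Prop where
  apply_s : ∀ φ m, α φ (s m) = φ.val (toFrac m) • s m
  apply_u : ∀ φ n, α φ (u n) = u n
  continuous : ∀ x, Continuous fun φ => α φ x

/-- `β` is the point-norm continuous action of the dual of `(R, +)` on `C^*({e_m} ∪ {u^n})` with
`β_χ(e_m) = e_m` and `β_χ(u^n) = χ(n) u^n`. -/
structure IsAddDualAction (β : Dual (Multiplicative R) →* (coreAlg R ≃⋆ₐ[ℂ] coreAlg R)) :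
    Prop where
  apply_e : ∀ χ m, β χ (coreE m) = coreE m
  apply_u : ∀ χ n, β χ (coreU n) = χ.val (Multiplicative.ofAdd n) • coreU n
  continuous : ∀ y, Continuous fun χ => β χ y

/-- `Θ` is obtained by averaging: for every `x`, the average `y` of `α_φ(x)` over the dual of
`Q(R)^×` lies in `C^*({e_m} ∪ {u^n})`, and `Θ(x)` is the average of `β_χ(y)` over the dual
of `(R, +)`. -/
def IsDoubleAverage (Θ : Alg R →L[ℂ] diagAlg R)
    (α : Dual (FractionRing R)ˣ →* (Alg R ≃⋆ₐ[ℂ] Alg R))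
    (β : Dual (Multiplicative R) →* (coreAlg R ≃⋆ₐ[ℂ] coreAlg R)) : Prop :=
  ∀ x : Alg R, ∃ y : coreAlg R,
    (y : Alg R) = ∫ φ, α φ x ∂(dualHaar (FractionRing R)ˣ) ∧
    (Θ x : Alg R) = ∫ χ, (β χ y : Alg R) ∂(dualHaar (Multiplicative R))

end Averages

end RingCStar

end

open scoped nonZeroDivisors

noncomputable section

namespace RingCStar

/-! ### Relations between the generators -/

/-! Every product of generators and adjoints is a linear combination of words `s_m^* u^a e_k u^b
s_{m'}`, so these span a dense subspace (`dense_wordSpan`). Two refinement facts make this work: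
`e_k` splits into the projections `u^{kc} e_{km} u^{-kc}` over the classes `c` modulo `m`
(`e_eq_sum`), and translates of one `e_m` are equal or orthogonal according to their cosets. Passing
to the common level `km` also gives commutativity of the diagonal algebra. Since the words are
dense, the standard formula determines a bounded map, and existence is proved by averaging.

The action `α` comes from the universal property, as multiplying each `s_m` by `φ(m)` preserves the
relations. A word is an eigenvector with character `φ(m'/m)`, so the first average kills it unless
`m = m'`. What survives is a compression by `s_m`, which expands into elements `u^x e_k u^y` with
`m(x + y) = a + b` (`compression_mem_span`) and so lies in the core `C^*({e_m} ∪ {u^n})`.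

The delicate point is `β`, because no presentation of the core is used to define it. If `χ` factors
through `R/(k)`, the twist `u^n ↦ χ(n) u^n` is conjugation by a unitary combination of the
projections `u^c e_k u^{-c}` (`charUnitary`). Hence, for a fixed polynomial in the `e_m` and the
twisted `u^n`, the norm is a continuous function on the dual of `(R, +)` that is invariant under all
such finite characters. As `R` is not a field, finitely many nonzero elements always have a nonzero
`k` dividing none of them, so an invariant continuous function is constant
(`eq_of_invariant_quotientChar`). Thus all twists are isometric on polynomials and extend to the
core (`norm_coreEval`). The second average then selects `a + b = 0`.

Both actions fix the diagonal algebra pointwise, which gives the identity and bimodule properties.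
Positivity and faithfulness hold because each integrand is continuous and positive, and its value at
the trivial character is the element being averaged (`eq_zero_of_integral_eq_zero`). -/

/-- All quotients of `R` by nonzero principal ideals are finite. -/
class HasFiniteQuotients (R : Type*) [CommRing R] : Prop where
  finite_quotient : ∀ m : R, m ≠ 0 → Finite (R ⧸ Ideal.span {m})

section Relations

variable {R : Type*} [CommRing R] [IsDomain R] [HasFiniteQuotients R]

instance (m : R⁰) : Finite (R ⧸ Ideal.span {(m : R)}) :=
  HasFiniteQuotients.finite_quotient _ (nonZeroDivisors.coe_ne_zero m)

instance (m : R⁰) : Fintype (R ⧸ Ideal.span {(m : R)}) := Fintype.ofFinite _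

theorem eq_of_rel {x y : Alg R} (h : Rel s u x y) : x = y :=
  satisfies_generators HasFiniteQuotients.finite_quotient x y h

@[simp]
theorem star_s_mul_s (m : R⁰) : star (s m) * s m = 1 := eq_of_rel (.isometry m)

theorem s_mul_s (k m : R⁰) : s k * s m = s (k * m) := eq_of_rel (.mul k m)

theorem u_mul_u (l n : R) : u l * u n = u (l + n) := eq_of_rel (.add l n)

theorem s_mul_u (m : R⁰) (n : R) : s m * u n = u (m * n) * s m := eq_of_rel (.comm m n)

theorem star_u_mul_u (n : R) : star (u n) * u n = 1 := eq_of_rel (.unitary_left n)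

@[simp]
theorem u_zero : u (0 : R) = 1 := by
  have h := u_mul_u (0 : R) 0
  rw [add_zero] at h
  calc u (0 : R) = star (u 0) * u 0 * u 0 := by rw [star_u_mul_u, one_mul]
    _ = 1 := by rw [mul_assoc, h, star_u_mul_u]

theorem star_u (n : R) : star (u n) = u (-n) := by
  calc star (u n) = star (u n) * (u n * u (-n)) := by
        rw [u_mul_u, add_neg_cancel, u_zero, mul_one]
    _ = u (-n) := by rw [← mul_assoc, star_u_mul_u, one_mul]

@[simp]
theorem u_mul_u_neg (n : R) : u n * u (-n) = 1 := by rw [u_mul_u, add_neg_cancel, u_zero]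

@[simp]
theorem u_neg_mul_u (n : R) : u (-n) * u n = 1 := by rw [u_mul_u, neg_add_cancel, u_zero]

@[simp]
theorem s_one : s (1 : R⁰) = 1 := by
  have h := s_mul_s (1 : R⁰) 1
  rw [one_mul] at h
  calc s (1 : R⁰) = star (s 1) * s 1 * s 1 := by rw [star_s_mul_s, one_mul]
    _ = 1 := by rw [mul_assoc, h, star_s_mul_s]

@[simp]
theorem e_one : e (1 : R⁰) = 1 := by simp [e]

@[simp]
theorem star_e (m : R⁰) : star (e m) = e m := by simp [e]

@[simp]
theorem e_mul_e (m : R⁰) : e m * e m = e m := by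
  rw [e, mul_assoc, ← mul_assoc (star (s m)), star_s_mul_s, one_mul]

@[simp]
theorem e_mul_s (m : R⁰) : e m * s m = s m := by rw [e, mul_assoc, star_s_mul_s, mul_one]

@[simp]
theorem star_s_mul_e (m : R⁰) : star (s m) * e m = star (s m) := by
  rw [e, ← mul_assoc, star_s_mul_s, one_mul]

theorem star_s_mul_star_s (k m : R⁰) : star (s k) * star (s m) = star (s (k * m)) := by
  rw [← star_mul, s_mul_s, mul_comm]

theorem u_mul_star_s (m : R⁰) (n : R) : u n * star (s m) = star (s m) * u (m * n) := by
  have h := congrArg star (s_mul_u m (-n))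
  rwa [star_mul, star_mul, star_u, star_u, mul_neg, neg_neg, neg_neg] at h

theorem s_mul_e (k m : R⁰) : s k * e m = e (k * m) * s k := by
  rw [e, e, ← s_mul_s, star_mul]
  simp only [mul_assoc, star_s_mul_s, mul_one]

/-- Moving an isometry past an adjoint. -/
theorem s_mul_star_s (l m : R⁰) : s l * star (s m) = star (s m) * e (m * l) * s l := by
  rw [mul_comm m l, mul_assoc, ← s_mul_e, ← mul_assoc]
  calc s l * star (s m) = star (s m) * s m * s l * star (s m) := by rw [star_s_mul_s, one_mul]
    -- Commutativity of `R` gives `s_m s_l = s_l s_m`, which brings `s_m` next to `s_m^*`.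
    _ = star (s m) * s l * e m := by
      rw [mul_assoc (star (s m)) (s m), s_mul_s, mul_comm m l, ← s_mul_s, e]
      simp only [mul_assoc]

/-! ### Translated range projections: orthogonality, refinement, commutativity -/

/-- The projection `u^n e_m u^{-n}`. -/
def proj (m : R⁰) (n : R) : Alg R := u n * e m * u (-n)

theorem proj_mem (m : R⁰) (n : R) : proj m n ∈ projSet R := ⟨m, n, rfl⟩

theorem proj_zero (m : R⁰) : proj m 0 = e m := by simp [proj]

theorem star_proj (m : R⁰) (n : R) : star (proj m n) = proj m n := by
  simp [proj, star_u, mul_assoc]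

theorem u_mul_proj (m : R⁰) (l n : R) : u l * proj m n = proj m (l + n) * u l := by
  rw [proj, proj, mul_assoc _ _ (u l), u_mul_u, ← mul_assoc, ← mul_assoc, u_mul_u]
  congr 2
  abel

theorem proj_mul_u (m : R⁰) (l n : R) : proj m n * u l = u l * proj m (n - l) := by
  rw [u_mul_proj, add_sub_cancel]

theorem proj_mul_self (m : R⁰) (n : R) : proj m n * proj m n = proj m n := by
  calc proj m n * proj m n = u n * e m * (u (-n) * u n) * e m * u (-n) := by
        simp only [proj, mul_assoc]
    _ = proj m n := by rw [u_neg_mul_u, mul_one, mul_assoc (u n), e_mul_e, proj]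

/-- Both sides equal `s_m u^t s_m^*`: translation by a multiple of `m` passes through `s_m`. Hence
the translates of `e_m` depend only on cosets of `(m)`. -/
theorem u_mul_e_of_dvd (m : R⁰) (t : R) : u (m * t) * e m = e m * u (m * t) := by
  rw [e, ← mul_assoc, ← s_mul_u, mul_assoc, mul_assoc, u_mul_star_s]

theorem proj_add_mul (m : R⁰) (n t : R) : proj m (n + m * t) = proj m n := by
  rw [proj, ← u_mul_u, mul_assoc (u n), u_mul_e_of_dvd, neg_add_rev, ← u_mul_u]
  calc u n * (e m * u (m * t)) * (u (-(m * t)) * u (-n))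
      = u n * e m * (u (m * t) * u (-(m * t))) * u (-n) := by simp only [mul_assoc]
    _ = _ := by rw [u_mul_u_neg, mul_one, proj]

theorem proj_congr {m : R⁰} {x y : R} (h : (m : R) ∣ x - y) : proj m x = proj m y := by
  obtain ⟨t, ht⟩ := h
  rw [← proj_add_mul m y t, ← ht, add_sub_cancel]

theorem proj_out_mk (m : R⁰) (x : R) :
    proj m (Quotient.out (Ideal.Quotient.mk (Ideal.span {(m : R)}) x)) = proj m x := by
  refine proj_congr ?_
  rw [← Ideal.mem_span_singleton, ← Ideal.Quotient.eq]
  exact Quotient.out_eq _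

theorem sum_proj (m : R⁰) : ∑ c : R ⧸ Ideal.span {(m : R)}, proj m (Quotient.out c) = 1 := by
  rw [← finsum_eq_sum_of_fintype]
  exact eq_of_rel (.partition m)

/-- Projections that add up to one are pairwise orthogonal. -/
theorem mul_eq_zero_of_sum_eq_one {A ι : Type*} [CStarAlgebra A] [Fintype ι] (p : ι → A)
    (hstar : ∀ i, star (p i) = p i) (hmul : ∀ i, p i * p i = p i) (hsum : ∑ i, p i = 1)
    {i j : ι} (hij : i ≠ j) : p i * p j = 0 := by
  classical
  let _ := CStarAlgebra.spectralOrder A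
  let _ := CStarAlgebra.spectralOrderedRing A
  -- Compressing `∑ p_k = 1` by `p_j` gives `∑ p_j p_k p_j = p_j`. The term `k = j` is already
  -- `p_j`, so the remaining positive terms `(p_k p_j)^* (p_k p_j)` sum to zero and each of them
  -- vanishes.
  have h1 : ∑ k ∈ Finset.univ.erase j, star (p k * p j) * (p k * p j) = 0 := by
    have h2 : ∑ k, star (p k * p j) * (p k * p j) = p j := by
      have : ∀ k, star (p k * p j) * (p k * p j) = p j * p k * p j := fun k => by
        rw [star_mul, hstar, hstar, mul_assoc, ← mul_assoc (p k), hmul, mul_assoc]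
      simp only [this]
      rw [← Finset.sum_mul, ← Finset.mul_sum, hsum, mul_one, hmul]
    rw [← Finset.add_sum_erase _ _ (Finset.mem_univ j), hmul, hstar, hmul] at h2
    simpa using h2
  have h3 := (Finset.sum_eq_zero_iff_of_nonneg fun k _ => star_mul_self_nonneg (p k * p j)).1 h1 i
    (by simp [hij])
  exact CStarRing.star_mul_self_eq_zero_iff _ |>.1 h3

theorem proj_mul_proj_of_not_dvd {m : R⁰} {x y : R} (h : ¬ (m : R) ∣ x - y) :
    proj m x * proj m y = 0 := by
  rw [← proj_out_mk m x, ← proj_out_mk m y]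
  refine mul_eq_zero_of_sum_eq_one
    (fun c : R ⧸ Ideal.span {(m : R)} => proj m (Quotient.out c)) (fun _ => star_proj _ _)
    (fun _ => proj_mul_self _ _) (sum_proj m) ?_
  rwa [Ne, Ideal.Quotient.eq, Ideal.mem_span_singleton]

/-- Inserting range projections turns the product into one containing `e_m (u^b e_m u^{-b})`, a
product of orthogonal projections. -/
theorem star_s_mul_u_mul_s_of_not_dvd {m : R⁰} {b : R} (h : ¬ (m : R) ∣ b) :
    star (s m) * u b * s m = 0 := by
  have h1 : proj m 0 * proj m b = 0 := proj_mul_proj_of_not_dvd (by simpa using h)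
  rw [proj_zero, proj] at h1
  calc star (s m) * u b * s m
      = star (s m) * (e m * (u b * e m * u (-b))) * (u b * s m) := by
        simp only [mul_assoc, ← mul_assoc (u (-b)), u_neg_mul_u, one_mul, e_mul_s]
        rw [← mul_assoc (star (s m)) (e m), star_s_mul_e]
    _ = 0 := by rw [h1, mul_zero, zero_mul]

theorem s_mul_e_mul_star_s (k m : R⁰) : s k * e m * star (s k) = e (k * m) := by
  rw [e, e, ← s_mul_s, star_mul]
  simp only [mul_assoc]

theorem s_mul_proj_mul_star_s (k m : R⁰) (n : R) :
    s k * proj m n * star (s k) = proj (k * m) (k * n) := by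
  rw [proj, proj, ← mul_assoc, ← mul_assoc, s_mul_u, mul_assoc, u_mul_star_s, mul_neg,
    ← s_mul_e_mul_star_s]
  simp only [mul_assoc]

/-- Conjugating the partition of unity at level `m` by `s_k` refines `e_k` to level `km`. This is
the device that brings any two range projections to a common level. -/
theorem e_eq_sum (k m : R⁰) : e k =
    ∑ c : R ⧸ Ideal.span {(m : R)}, proj (k * m) (k * Quotient.out c) := by
  calc e k = s k * 1 * star (s k) := by rw [mul_one, e]
    _ = _ := by
      rw [← sum_proj m, Finset.mul_sum, Finset.sum_mul]
      exact Finset.sum_congr rfl fun c _ => s_mul_proj_mul_star_s _ _ _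

theorem u_mul_proj_mul_u (m : R⁰) (a n b : R) :
    u a * proj m n * u b = u (a + n) * e m * u (-n + b) := by
  rw [proj, ← u_mul_u, ← u_mul_u]
  simp only [mul_assoc]

theorem u_mul_e_mul_u_eq_sum (k m : R⁰) (a b : R) : u a * e k * u b =
    ∑ c : R ⧸ Ideal.span {(m : R)},
      u (a + k * Quotient.out c) * e (k * m) * u (-(k * Quotient.out c) + b) := by
  rw [e_eq_sum k m, Finset.mul_sum, Finset.sum_mul]
  exact Finset.sum_congr rfl fun c _ => u_mul_proj_mul_u _ _ _ _

theorem proj_eq_sum (k m : R⁰) (n : R) : proj k n =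
    ∑ c : R ⧸ Ideal.span {(m : R)}, proj (k * m) (n + k * Quotient.out c) := by
  rw [proj, u_mul_e_mul_u_eq_sum k m]
  refine Finset.sum_congr rfl fun c _ => ?_
  rw [proj, neg_add_rev]

theorem commute_proj_same (m : R⁰) (x y : R) : Commute (proj m x) (proj m y) := by
  by_cases h : (m : R) ∣ x - y
  · rw [proj_congr h]
  · have h' : ¬ (m : R) ∣ y - x := by rwa [dvd_sub_comm]
    rw [Commute, SemiconjBy, proj_mul_proj_of_not_dvd h, proj_mul_proj_of_not_dvd h']

/-- At the common level `km` both projections are sums of translates of `e_{km}`, and any two such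
translates are equal or orthogonal. -/
theorem commute_proj (k m : R⁰) (x y : R) : Commute (proj k x) (proj m y) := by
  rw [proj_eq_sum k m, proj_eq_sum m k, mul_comm m k]
  exact Commute.sum_left _ _ _ fun c _ => Commute.sum_right _ _ _ fun d _ =>
    commute_proj_same _ _ _

/-- `𝔇[R]` is commutative. -/
theorem diagAlg_mul_comm : ∀ x ∈ diagAlg R, ∀ y ∈ diagAlg R, x * y = y * x := by
  have h : ∀ x ∈ projSet R, ∀ y ∈ projSet R, x * y = y * x := by
    rintro _ ⟨k, a, rfl⟩ _ ⟨m, b, rfl⟩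
    exact commute_proj k m a b
  have hs : ∀ x ∈ projSet R, ∀ y ∈ projSet R, x * star y = star y * x := by
    rintro x hx _ ⟨m, b, rfl⟩
    change x * star (proj m b) = star (proj m b) * x
    rw [star_proj]
    exact h x hx _ (proj_mem m b)
  -- `P` is commutative and self-adjoint, so the closed algebra it generates lies in the commutant
  -- of `P`. It also lies in the bicommutant, whose elements commute with the commutant.
  have h1 : diagAlg R ≤ StarSubalgebra.centralizer ℂ (projSet R) := by
    refine StarSubalgebra.topologicalClosure_minimal
      (StarAlgebra.adjoin_le fun x hx => ?_) (Set.isClosed_centralizer _)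
    exact StarSubalgebra.mem_centralizer_iff ℂ |>.2 fun y hy =>
      ⟨h y hy x hx, (hs x hx y hy).symm⟩
  have h2 := StarSubalgebra.topologicalClosure_adjoin_le_centralizer_centralizer ℂ (projSet R)
  intro x hx y hy
  exact ((StarSubalgebra.mem_centralizer_iff ℂ).1 (h2 hx) y (h1 hy)).1.symm

/-! ### The dense span of words -/

theorem e_mul_u_mul_e_of_dvd (m : R⁰) (t : R) :
    e m * u (m * t) * e m = u (m * t) * e m := by
  rw [← u_mul_e_of_dvd, mul_assoc, e_mul_e]

theorem e_mul_u_mul_e_of_not_dvd {m : R⁰} {b : R} (h : ¬ (m : R) ∣ b) :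
    e m * u b * e m = 0 := by
  calc e m * u b * e m = s m * (star (s m) * u b * s m) * star (s m) := by
        simp only [e, mul_assoc]
    _ = 0 := by rw [star_s_mul_u_mul_s_of_not_dvd h, mul_zero, zero_mul]

variable (R) in
/-- The linear span of the elements `u^a e_k u^b`. -/
def coreSpan : Submodule ℂ (Alg R) :=
  Submodule.span ℂ {x | ∃ (k : R⁰) (a b : R), x = u a * e k * u b}

variable (R) in
/-- The linear span of the elements `s_m^* u^a e_k u^b s_{m'}`. -/
def wordSpan : Submodule ℂ (Alg R) :=
  Submodule.span ℂ {x | ∃ (m m' k : R⁰) (a b : R),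
    x = star (s m) * (u a * e k * u b) * s m'}

theorem mem_coreSpan (k : R⁰) (a b : R) : u a * e k * u b ∈ coreSpan R :=
  Submodule.subset_span ⟨k, a, b, rfl⟩

theorem e_mul_u_mul_e_mem (k : R⁰) (a b c : R) :
    u a * (e k * u b * e k) * u c ∈ coreSpan R := by
  by_cases h : (k : R) ∣ b
  · obtain ⟨t, rfl⟩ := h
    rw [e_mul_u_mul_e_of_dvd, ← mul_assoc, u_mul_u]
    exact mem_coreSpan _ _ _
  · rw [e_mul_u_mul_e_of_not_dvd h]
    simp

/-- Refining both projections to level `jk` leaves products `e_{jk} u^b e_{jk}` in the middle, and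
each of these either collapses to `u^b e_{jk}` or vanishes. -/
theorem e_mul_core_mem (j k : R⁰) (a b : R) : e j * (u a * e k * u b) ∈ coreSpan R := by
  have h1 := u_mul_e_mul_u_eq_sum j k 0 0
  rw [u_zero, one_mul, mul_one] at h1
  rw [h1, u_mul_e_mul_u_eq_sum k j, mul_comm k j, Finset.sum_mul]
  refine Submodule.sum_mem _ fun c _ => ?_
  rw [Finset.mul_sum]
  refine Submodule.sum_mem _ fun d _ => ?_
  set x := -((j : R) * Quotient.out c) + 0
  set y := a + (k : R) * Quotient.out d
  convert e_mul_u_mul_e_mem (j * k) (0 + (j : R) * Quotient.out c) (x + y)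
    (-((k : R) * Quotient.out d) + b) using 1
  rw [← u_mul_u x y]
  simp only [mul_assoc]

theorem core_mul_s_mem {y : Alg R} (hy : y ∈ coreSpan R) (m m' : R⁰) :
    star (s m) * y * s m' ∈ wordSpan R := by
  induction hy using Submodule.span_induction with
  | mem x hx =>
    obtain ⟨k, a, b, rfl⟩ := hx
    exact Submodule.subset_span ⟨m, m', k, a, b, rfl⟩
  | zero => simp
  | add x y _ _ hx hy => rw [mul_add, add_mul]; exact add_mem hx hy
  | smul c x _ hx =>
    rw [mul_smul_comm, smul_mul_assoc]
    exact Submodule.smul_mem _ _ hx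

theorem star_s_mul_mem (l : R⁰) {x : Alg R} (hx : x ∈ wordSpan R) :
    star (s l) * x ∈ wordSpan R := by
  induction hx using Submodule.span_induction with
  | mem x hx =>
    obtain ⟨m, m', k, a, b, rfl⟩ := hx
    rw [← mul_assoc, ← mul_assoc, star_s_mul_star_s]
    exact Submodule.subset_span ⟨l * m, m', k, a, b, rfl⟩
  | zero => simp
  | add x y _ _ hx hy => rw [mul_add]; exact add_mem hx hy
  | smul c x _ hx => rw [mul_smul_comm]; exact Submodule.smul_mem _ _ hx

theorem u_mul_mem (n : R) {x : Alg R} (hx : x ∈ wordSpan R) : u n * x ∈ wordSpan R := by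
  induction hx using Submodule.span_induction with
  | mem x hx =>
    obtain ⟨m, m', k, a, b, rfl⟩ := hx
    refine Submodule.subset_span ⟨m, m', k, m * n + a, b, ?_⟩
    rw [← u_mul_u, ← mul_assoc, ← mul_assoc, u_mul_star_s]
    simp only [mul_assoc]
  | zero => simp
  | add x y _ _ hx hy => rw [mul_add]; exact add_mem hx hy
  | smul c x _ hx => rw [mul_smul_comm]; exact Submodule.smul_mem _ _ hx

theorem s_mul_core (l k : R⁰) (a b : R) :
    s l * (u a * e k * u b) = u (l * a) * e (l * k) * u (l * b) * s l := by
  rw [← mul_assoc, ← mul_assoc, s_mul_u, mul_assoc _ (s l), s_mul_e, ← mul_assoc,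
    mul_assoc _ (s l), s_mul_u, ← mul_assoc]

/-- This is the one generator that does not simply merge with the left end of a word. Moving `s_l`
past `s_m^*` creates the factor `e_{ml}`, then `s_l` travels through the middle and joins `s_{m'}`;
the extra `e_{ml}` is absorbed by `e_mul_core_mem`. -/
theorem s_mul_mem (l : R⁰) {x : Alg R} (hx : x ∈ wordSpan R) : s l * x ∈ wordSpan R := by
  induction hx using Submodule.span_induction with
  | mem x hx =>
    obtain ⟨m, m', k, a, b, rfl⟩ := hx
    have h := core_mul_s_mem (e_mul_core_mem (m * l) (l * k) (l * a) (l * b)) m (l * m')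
    convert h using 1
    rw [← mul_assoc, ← mul_assoc, s_mul_star_s, mul_assoc _ (s l), s_mul_core, ← s_mul_s]
    simp only [mul_assoc]
  | zero => simp
  | add x y _ _ hx hy => rw [mul_add]; exact add_mem hx hy
  | smul c x _ hx => rw [mul_smul_comm]; exact Submodule.smul_mem _ _ hx

theorem one_mem_wordSpan : (1 : Alg R) ∈ wordSpan R :=
  Submodule.subset_span ⟨1, 1, 1, 0, 0, by simp⟩

theorem ofPre_mem_wordSpan (a : Pre R) : ofPre a ∈ wordSpan R := by
  -- Invariance under left multiplication is the form that survives induction over products: closure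
  -- of the span under multiplication need not be known beforehand.
  suffices h : ∀ x ∈ wordSpan R, ofPre a * x ∈ wordSpan R by
    simpa using h 1 one_mem_wordSpan
  induction a using FreeStarAlg.induction_on with
  | h_scalar c =>
    intro x hx
    rw [Algebra.algebraMap_eq_smul_one, ofPre_smul, map_one, smul_mul_assoc, one_mul]
    exact Submodule.smul_mem _ _ hx
  | h_letter y b =>
    intro x hx
    have hl : FreeStarAlg.letter y true = star (FreeStarAlg.gen y) := by
      rw [FreeStarAlg.gen, FreeStarAlg.star_letter]; rfl
    cases b with
    | false =>
      rcases y with m | n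
      · exact s_mul_mem m hx
      · exact u_mul_mem n hx
    | true =>
      rw [hl, ← star_ofPre]
      rcases y with m | n
      · exact star_s_mul_mem m hx
      · change star (u n) * x ∈ _
        rw [star_u]
        exact u_mul_mem _ hx
  | h_add a b ha hb =>
    intro x hx
    rw [map_add, add_mul]
    exact add_mem (ha x hx) (hb x hx)
  | h_mul a b ha hb =>
    intro x hx
    rw [map_mul, mul_assoc]
    exact ha _ (hb x hx)

theorem dense_wordSpan : Dense (wordSpan R : Set (Alg R)) :=
  denseRange_ofPre.mono (Set.range_subset_iff.2 ofPre_mem_wordSpan)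

/-- Induction on the spanning words, for closed linear conditions. -/
theorem word_induction {P : Alg R → Prop} (hc : IsClosed {x | P x}) (h0 : P 0)
    (hadd : ∀ x y, P x → P y → P (x + y)) (hsmul : ∀ (c : ℂ) x, P x → P (c • x))
    (h : ∀ (m m' k : R⁰) (a b : R), P (star (s m) * (u a * e k * u b) * s m')) (x : Alg R) :
    P x := by
  refine dense_wordSpan.induction (P := P) (fun x hx => ?_) hc x
  induction hx using Submodule.span_induction with
  | mem x hx => obtain ⟨m, m', k, a, b, rfl⟩ := hx; exact h _ _ _ _ _
  | zero => exact h0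
  | add x y _ _ hx hy => exact hadd _ _ hx hy
  | smul c x _ hx => exact hsmul _ _ hx

/-! ### Compressions by the isometries -/

theorem star_s_mul_core_mul_s (m k : R⁰) (x y : R) :
    star (s m) * (u (m * x) * e (k * m) * u (m * y)) * s m = u x * e k * u y := by
  have h1 := s_mul_core m k x y
  rw [mul_comm k m, mul_assoc, ← h1, ← mul_assoc, star_s_mul_s, one_mul]

/-- Writing `e_{km} = s_m e_k s_m^*` factors the compression as `(s_m^* u^x s_m) e_k (s_m^* u^y
s_m)`, where an outer factor is zero as soon as `m` does not divide its exponent. -/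
theorem star_s_mul_core_mul_s_of_not_dvd {m k : R⁰} {x y : R}
    (h : ¬ ((m : R) ∣ x ∧ (m : R) ∣ y)) :
    star (s m) * (u x * e (k * m) * u y) * s m = 0 := by
  have h1 : star (s m) * (u x * e (k * m) * u y) * s m =
      star (s m) * u x * s m * e k * (star (s m) * u y * s m) := by
    rw [mul_comm k m, ← s_mul_e_mul_star_s]
    simp only [mul_assoc]
  rw [h1]
  by_cases hx : (m : R) ∣ x
  · rw [star_s_mul_u_mul_s_of_not_dvd (b := y) (fun hy => h ⟨hx, hy⟩), mul_zero]
  · rw [star_s_mul_u_mul_s_of_not_dvd hx, zero_mul, zero_mul]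

/-- Compressions of the elements `u^a e_k u^b` by `s_m`, as sums of such elements with the same
total degree. -/
theorem compression_mem_span (m k : R⁰) (a b : R) :
    star (s m) * (u a * e k * u b) * s m ∈
      Submodule.span ℂ {z | ∃ x y : R, m * (x + y) = a + b ∧ z = u x * e k * u y} := by
  -- At level `km` every summand has a compression that is either explicit or zero, and the
  -- exponents on the two sides of `e_{km}` still add up to `a + b`.
  rw [u_mul_e_mul_u_eq_sum k m, Finset.mul_sum, Finset.sum_mul]
  refine Submodule.sum_mem _ fun c _ => ?_
  by_cases h : (m : R) ∣ a + k * Quotient.out c ∧ (m : R) ∣ -(k * Quotient.out c) + b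
  · obtain ⟨⟨x, hx⟩, y, hy⟩ := h
    rw [hx, hy, star_s_mul_core_mul_s]
    refine Submodule.subset_span ⟨x, y, ?_, rfl⟩
    rw [mul_add, ← hx, ← hy]
    abel
  · rw [star_s_mul_core_mul_s_of_not_dvd h]
    exact Submodule.zero_mem _

end Relations

/-! ### Characters of discrete groups -/

section Characters

variable {G : Type*} [CommGroup G]

/-- The homomorphism `ℚ / ℤ → ℝ / ℤ`. -/
def ratAddCircle : AddCircle (1 : ℚ) →+ AddCircle (1 : ℝ) :=
  QuotientAddGroup.map _ _ (Rat.castHom ℝ).toAddMonoidHom (by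
    rw [AddSubgroup.zmultiples_le, AddSubgroup.mem_comap]
    exact AddSubgroup.mem_zmultiples_iff.2 ⟨1, by simp⟩)

theorem ratAddCircle_injective : Function.Injective ratAddCircle := by
  rw [injective_iff_map_eq_zero]
  intro x hx
  induction x using QuotientAddGroup.induction_on with
  | H q =>
    have h : ((q : ℝ) : AddCircle (1 : ℝ)) = 0 := hx
    obtain ⟨n, hn⟩ := (AddCircle.coe_eq_zero_iff 1).1 h
    refine (AddCircle.coe_eq_zero_iff 1).2 ⟨n, ?_⟩
    simp only [zsmul_eq_mul, mul_one] at hn ⊢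
    exact_mod_cast hn

/-- A character of the discrete group `G`, from a homomorphism to the circle. -/
def Dual.ofHom (f : G →* Circle) : Dual G :=
  ⟨(f : Disc G →* Circle), continuous_of_discreteTopology⟩

/-- Characters with values in `ℚ / ℤ` separate the points of any abelian group; the embedding of `ℚ
/ ℤ` into `ℝ / ℤ` and then into the circle keeps the value nontrivial. -/
theorem Dual.exists_val_ne_one {g : G} (hg : g ≠ 1) : ∃ χ : Dual G, χ.val g ≠ 1 := by
  obtain ⟨c, hc⟩ := CharacterModule.exists_character_apply_ne_zero_of_ne_zero
    (A := Additive G) (a := Additive.ofMul g) (by simpa using hg)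
  let f : G →* Circle :=
    { toFun := fun x => AddCircle.toCircle (ratAddCircle (c (Additive.ofMul x)))
      map_one' := by simp
      map_mul' := fun x y => by rw [ofMul_mul, map_add, map_add, AddCircle.toCircle_add] }
  refine ⟨Dual.ofHom f, fun h => hc (ratAddCircle_injective ?_)⟩
  refine AddCircle.injective_toCircle one_ne_zero ?_
  rw [map_zero, AddCircle.toCircle_zero]
  exact Circle.coe_eq_one.1 h

@[simp]
theorem Dual.val_one_apply (g : G) : (1 : Dual G).val g = 1 := rfl

@[simp]
theorem Dual.val_map_one (χ : Dual G) : χ.val 1 = 1 :=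
  Circle.coe_eq_one.2 (map_one χ)

theorem Dual.val_mul_apply (χ ψ : Dual G) (g : G) : (χ * ψ).val g = χ.val g * ψ.val g := rfl

theorem Dual.val_map_mul (χ : Dual G) (g h : G) : χ.val (g * h) = χ.val g * χ.val h :=
  congrArg (fun z : Circle => (z : ℂ)) (map_mul χ (show Disc G from g) (show Disc G from h))

theorem Dual.star_val_mul_val (χ : Dual G) (g : G) : star (χ.val g) * χ.val g = 1 := by
  rw [Dual.val, Complex.star_def, ← Circle.coe_inv_eq_conj, ← Circle.coe_mul, inv_mul_cancel,
    Circle.coe_one]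

theorem Dual.val_mul_star_val (χ : Dual G) (g : G) : χ.val g * star (χ.val g) = 1 := by
  rw [mul_comm, Dual.star_val_mul_val]

theorem Dual.val_map_inv (χ : Dual G) (g : G) : χ.val g⁻¹ = star (χ.val g) := by
  have h : χ.val g⁻¹ * χ.val g = 1 := by
    rw [← Dual.val_map_mul, inv_mul_cancel, Dual.val_map_one]
  calc χ.val g⁻¹ = χ.val g⁻¹ * (χ.val g * star (χ.val g)) := by
        rw [Dual.val_mul_star_val, mul_one]
    _ = star (χ.val g) := by rw [← mul_assoc, h, one_mul]

theorem Dual.continuous_val (g : G) : Continuous fun χ : Dual G => χ.val g := by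
  have h := (ContinuousMonoidHom.isInducing_toContinuousMap (Disc G) Circle).continuous
  exact continuous_subtype_val.comp <| (ContinuousEvalConst.continuous_eval_const
    (F := C(Disc G, Circle)) (show Disc G from g)).comp h

theorem Dual.val_injective : Function.Injective (Dual.val : Dual G → G → ℂ) := by
  intro χ ψ h
  refine PontryaginDual.ext fun g => ?_
  exact Circle.ext (congrFun h g)

instance : MeasureTheory.IsProbabilityMeasure (dualHaar G) :=
  ⟨MeasureTheory.Measure.haarMeasure_self⟩

instance : (dualHaar G).IsHaarMeasure :=
  MeasureTheory.Measure.isHaarMeasure_haarMeasure _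

/-- Translation by a character `ψ` with `ψ(g) ≠ 1` multiplies the integral by `ψ(g)` but, by
invariance of Haar measure, does not change it. -/
theorem integral_val_of_ne_one {g : G} (hg : g ≠ 1) : ∫ χ, χ.val g ∂(dualHaar G) = 0 := by
  obtain ⟨ψ, hψ⟩ := Dual.exists_val_ne_one hg
  have h : ∫ χ, (ψ * χ).val g ∂(dualHaar G) = ∫ χ, χ.val g ∂(dualHaar G) :=
    MeasureTheory.integral_mul_left_eq_self (fun χ : Dual G => χ.val g) ψ
  simp only [Dual.val_mul_apply] at h
  rw [MeasureTheory.integral_const_mul] at h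
  have h2 : (ψ.val g - 1) * ∫ χ, χ.val g ∂(dualHaar G) = 0 := by rw [sub_mul, h, one_mul, sub_self]
  exact (mul_eq_zero.1 h2).resolve_left (sub_ne_zero.2 hψ)

theorem integral_val (g : G) : ∫ χ, χ.val g ∂(dualHaar G) = delta g 1 := by
  by_cases hg : g = 1
  · subst hg
    simp [delta]
  · rw [integral_val_of_ne_one hg, delta, if_neg hg]

theorem integrable_of_continuous {E : Type*} [NormedAddCommGroup E] {f : Dual G → E}
    (hf : Continuous f) : MeasureTheory.Integrable f (dualHaar G) :=
  hf.integrable_of_hasCompactSupport (HasCompactSupport.of_compactSpace f)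

end Characters

/-! ### Positive elements -/

section Positive

variable {A : Type*} [CStarAlgebra A] [PartialOrder A] [StarOrderedRing A]

/-- The square root given by the continuous functional calculus stays in a closed `*`-subalgebra, so
positivity in `A` is witnessed inside `D`. -/
theorem exists_star_mul_self_of_nonneg (D : StarSubalgebra ℂ A) (hD : IsClosed (D : Set A))
    (d : D) (hd : 0 ≤ (d : A)) : ∃ y : D, d = star y * y := by
  have hmem : cfc Real.sqrt (d : A) ∈ D := cfc_mem (𝕜' := ℂ) (hs := hD) Real.sqrt d.2
  have hsa : star (cfc Real.sqrt (d : A)) = cfc Real.sqrt (d : A) :=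
    (cfc_predicate Real.sqrt (d : A)).star_eq
  refine ⟨⟨_, hmem⟩, Subtype.ext ?_⟩
  change (d : A) = star (cfc Real.sqrt (d : A)) * cfc Real.sqrt (d : A)
  rw [hsa, ← cfc_mul Real.sqrt Real.sqrt (d : A)]
  have hsd : IsSelfAdjoint (d : A) := IsSelfAdjoint.of_nonneg hd
  conv_lhs => rw [← cfc_id' ℝ (d : A)]
  refine cfc_congr fun x hx => ?_
  exact (Real.mul_self_sqrt (spectrum_nonneg_of_nonneg hd hx)).symm

/-- If `f χ ≠ 0`, then `-f χ` is outside the closed positive cone, and Hahn–Banach gives a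
functional that is nonnegative on the cone and positive at `f χ`. Composed with `f` it is a
continuous nonnegative function with a positive value, so its Haar integral is positive. -/
theorem eq_zero_of_integral_eq_zero {G : Type*} [CommGroup G]
    {f : Dual G → A} (hf : Continuous f) (hpos : ∀ χ, 0 ≤ f χ)
    (h : ∫ χ, f χ ∂(dualHaar G) = 0) (χ : Dual G) : f χ = 0 := by
  by_contra hne
  have hneg : -f χ ∉ ProperCone.positive ℝ A := fun hmem =>
    hne (le_antisymm (neg_nonneg.1 hmem) (hpos χ))
  obtain ⟨ω, hω, hlt⟩ := ProperCone.hyperplane_separation_point _ hneg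
  rw [map_neg, neg_lt_zero] at hlt
  have hpos' : 0 < ∫ ψ, ω (f ψ) ∂(dualHaar G) :=
    Continuous.integral_pos_of_hasCompactSupport_nonneg_nonzero (x := χ)
      (ω.continuous.comp hf) (HasCompactSupport.of_compactSpace _) (fun ψ => hω _ (hpos ψ)) hlt.ne'
  rw [ContinuousLinearMap.integral_comp_comm ω (integrable_of_continuous hf), h, map_zero] at hpos'
  exact hpos'.false

end Positive

/-! ### Evaluation of the free `*`-algebra -/

section Eval

variable {R : Type*} [CommRing R]

theorem map_evalPre {B C : Type*} [CStarAlgebra B] [CStarAlgebra C] (ρ : B →⋆ₐ[ℂ] C)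
    (s' : R⁰ → B) (u' : R → B) (a : Pre R) :
    ρ (evalPre s' u' a) = evalPre (fun m => ρ (s' m)) (fun n => ρ (u' n)) a := by
  induction a using FreeStarAlg.induction_on with
  | h_scalar c => rw [AlgHom.commutes, AlgHom.commutes, AlgHomClass.commutes]
  | h_letter x b =>
    rw [evalPre_letter, evalPre_letter]
    cases b <;> rcases x with m | n <;> simp [map_star ρ]
  | h_add a b ha hb => rw [map_add, map_add, map_add, ha, hb]
  | h_mul a b ha hb => rw [map_mul, map_mul, map_mul, ha, hb]

theorem evalPre_generators (a : Pre R) : evalPre s u a = ofPre a := by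
  induction a using FreeStarAlg.induction_on with
  | h_scalar c =>
    rw [AlgHom.commutes, Algebra.algebraMap_eq_smul_one, Algebra.algebraMap_eq_smul_one, ofPre_smul,
      map_one]
  | h_letter x b =>
    rw [evalPre_letter]
    have hgen : Sum.elim s u x = ofPre (FreeStarAlg.gen x) := by rcases x with m | n <;> rfl
    cases b with
    | false => rw [if_neg Bool.false_ne_true, hgen, FreeStarAlg.gen]
    | true =>
      rw [if_pos rfl, hgen, star_ofPre, FreeStarAlg.gen, FreeStarAlg.star_letter]
      rfl
  | h_add a b ha hb => rw [map_add, map_add, ha, hb]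
  | h_mul a b ha hb => rw [map_mul, map_mul, ha, hb]

theorem map_ofPre {B : Type*} [CStarAlgebra B] (ρ : Alg R →⋆ₐ[ℂ] B) (a : Pre R) :
    ρ (ofPre a) = evalPre (fun m => ρ (s m)) (fun n => ρ (u n)) a := by
  rw [← evalPre_generators, map_evalPre]

open scoped CStarAlgebra in
theorem continuous_starAlgHom {A B : Type*} [CStarAlgebra A] [CStarAlgebra B] (ρ : A →⋆ₐ[ℂ] B) :
    Continuous ρ := map_continuous ρ

theorem norm_starAlgHom_le {A B : Type*} [CStarAlgebra A] [CStarAlgebra B] (ρ : A →⋆ₐ[ℂ] B)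
    (x : A) : ‖ρ x‖ ≤ ‖x‖ := NonUnitalStarAlgHom.norm_apply_le ρ x

theorem algHom_ext {B : Type*} [CStarAlgebra B] {ρ σ : Alg R →⋆ₐ[ℂ] B}
    (hs : ∀ m, ρ (s m) = σ (s m)) (hu : ∀ n, ρ (u n) = σ (u n)) : ρ = σ := by
  ext x
  refine alg_induction (P := fun x => ρ x = σ x)
    (isClosed_eq (continuous_starAlgHom ρ) (continuous_starAlgHom σ)) (fun a => ?_) x
  simp only [map_ofPre, hs, hu]

theorem continuous_evalPre {X B : Type*} [TopologicalSpace X] [CStarAlgebra B] {s' : X → R⁰ → B}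
    {u' : X → R → B} (hs : ∀ m, Continuous fun x => s' x m) (hu : ∀ n, Continuous fun x => u' x n)
    (a : Pre R) : Continuous fun x => evalPre (s' x) (u' x) a := by
  induction a using FreeStarAlg.induction_on with
  | h_scalar c => simpa only [AlgHom.commutes] using continuous_const
  | h_letter x b =>
    simp only [evalPre_letter]
    cases b <;> rcases x with m | n <;> simp [hs, hu, (hs _).star, (hu _).star]
  | h_add a b ha hb => simp only [map_add]; exact ha.add hb
  | h_mul a b ha hb => simp only [map_mul]; exact ha.mul hb

end Eval

/-- Strong continuity of a family of contractions may be checked on a dense set. -/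
theorem continuous_apply_of_dense {X A B : Type*} [TopologicalSpace X] [NormedAddCommGroup A]
    [NormedAddCommGroup B] (f : X → A → B) (hf : ∀ x a b, ‖f x a - f x b‖ ≤ ‖a - b‖) {D : Set A}
    (hD : Dense D) (h : ∀ a ∈ D, Continuous fun x => f x a) (a : A) :
    Continuous fun x => f x a := by
  refine continuous_of_uniform_approx_of_continuous fun U hU => ?_
  obtain ⟨ε, hε, hU⟩ := Metric.mem_uniformity_dist.1 hU
  obtain ⟨b, hbD, hb⟩ := hD.exists_dist_lt a hε
  refine ⟨fun x => f x b, h b hbD, fun x => hU ?_⟩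
  rw [dist_eq_norm] at hb ⊢
  exact (hf x a b).trans_lt hb

/-- An action by automorphisms, from an action by endomorphisms. -/
def actionOfHoms {G A : Type*} [Group G] [Semiring A] [Algebra ℂ A] [Star A]
    (f : G → A →⋆ₐ[ℂ] A) (h_one : ∀ x, f 1 x = x) (h_mul : ∀ g h x, f (g * h) x = f g (f h x)) :
    G →* (A ≃⋆ₐ[ℂ] A) where
  toFun g := StarAlgEquiv.ofStarAlgHom (f g) (f g⁻¹)
    (by ext x; simp [← h_mul, h_one]) (by ext x; simp [← h_mul, h_one])
  map_one' := by ext x; exact h_one x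
  map_mul' g h := by ext x; exact h_mul g h x

/-! ### The action of the dual of `Q(R)^×` -/

section MulAction

variable {R : Type*} [CommRing R] [IsDomain R] [HasFiniteQuotients R]

theorem toFrac_mul (k m : R⁰) : toFrac (k * m) = toFrac k * toFrac m := by
  ext
  simp [toFrac]

theorem toFrac_injective : Function.Injective (toFrac : R⁰ → (FractionRing R)ˣ) := by
  intro k m h
  have h1 := congrArg Units.val h
  simp only [toFrac, IsUnit.unit_spec] at h1
  exact Subtype.ext (IsFractionRing.injective R (FractionRing R) h1)

/-- Unimodular scalars cancel in `s_m^* s_m` and `s_m s_m^*`, and the relation `s_k s_m = s_{km}`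
survives because `φ` is multiplicative. -/
theorem satisfies_mulTwist (φ : Dual (FractionRing R)ˣ) :
    Satisfies (fun m => φ.val (toFrac m) • s m) (u (R := R)) := by
  have he : ∀ m : R⁰, φ.val (toFrac m) • s m * star (φ.val (toFrac m) • s m) = e m := fun m => by
    rw [star_smul, smul_mul_smul_comm, Dual.val_mul_star_val, one_smul, e]
  intro x y h
  cases h with
  | isometry m =>
    rw [star_smul, smul_mul_smul_comm, Dual.star_val_mul_val, one_smul, star_s_mul_s]
  | unitary_left n => exact eq_of_rel (.unitary_left n)
  | unitary_right n => exact eq_of_rel (.unitary_right n)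
  | mul k m => rw [smul_mul_smul_comm, s_mul_s, toFrac_mul, Dual.val_map_mul]
  | add l n => exact eq_of_rel (.add l n)
  | comm m n => rw [smul_mul_assoc, s_mul_u, mul_smul_comm]
  | partition m => simp only [he]; exact eq_of_rel (.partition m)

theorem exists_mulTwist (φ : Dual (FractionRing R)ˣ) : ∃ π : Alg R →⋆ₐ[ℂ] Alg R,
    (∀ m, π (s m) = φ.val (toFrac m) • s m) ∧ ∀ n, π (u n) = u n :=
  (existsUnique_lift HasFiniteQuotients.finite_quotient _ _ (satisfies_mulTwist φ)).exists

/-- The endomorphism of `𝔄[R]` that multiplies `s_m` by `φ(m)`. -/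
def mulTwist (φ : Dual (FractionRing R)ˣ) : Alg R →⋆ₐ[ℂ] Alg R := (exists_mulTwist φ).choose

@[simp]
theorem mulTwist_s (φ : Dual (FractionRing R)ˣ) (m : R⁰) :
    mulTwist φ (s m) = φ.val (toFrac m) • s m := (exists_mulTwist φ).choose_spec.1 m

@[simp]
theorem mulTwist_u (φ : Dual (FractionRing R)ˣ) (n : R) : mulTwist φ (u n) = u n :=
  (exists_mulTwist φ).choose_spec.2 n

@[simp]
theorem mulTwist_e (φ : Dual (FractionRing R)ˣ) (m : R⁰) : mulTwist φ (e m) = e m := by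
  rw [e, map_mul, map_star, mulTwist_s, star_smul, smul_mul_smul_comm, Dual.val_mul_star_val,
    one_smul]

variable (R) in
/-- The action of the dual of `Q(R)^×` on `𝔄[R]`. -/
def mulAction : Dual (FractionRing R)ˣ →* (Alg R ≃⋆ₐ[ℂ] Alg R) :=
  actionOfHoms mulTwist
    (fun x => by
      have h : mulTwist (1 : Dual (FractionRing R)ˣ) = StarAlgHom.id ℂ (Alg R) :=
        algHom_ext (by simp) (by simp)
      rw [h, StarAlgHom.coe_id, id])
    (fun φ ψ x => by
      have h : mulTwist (φ * ψ) = (mulTwist φ).comp (mulTwist (R := R) ψ) :=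
        algHom_ext
          (by simp [Dual.val_mul_apply, smul_smul, mul_comm]) (by simp)
      rw [h, StarAlgHom.comp_apply])

theorem isMulDualAction_mulAction : IsMulDualAction (mulAction R) where
  apply_s := mulTwist_s
  apply_u := mulTwist_u
  continuous := by
    refine continuous_apply_of_dense (fun φ x => mulTwist φ x) (fun φ a b => ?_)
      denseRange_ofPre ?_
    · rw [← map_sub]
      exact norm_starAlgHom_le (mulTwist φ) (a - b)
    · rintro _ ⟨a, rfl⟩
      simp only [map_ofPre]
      refine continuous_evalPre (fun m => ?_) (fun n => ?_) a
      · simp only [mulTwist_s]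
        exact (Dual.continuous_val (toFrac m)).smul continuous_const
      · simp only [mulTwist_u]
        exact continuous_const

end MulAction

/-! ### Functions on the dual group that are invariant under finite characters -/

section Invariant

variable {R : Type*} [CommRing R]

/-- The character of `(R, +)` given by a character of `R / (k)`. -/
def quotientChar (k : R) (γ : AddChar (R ⧸ Ideal.span {k}) Circle) : Dual (Multiplicative R) :=
  Dual.ofHom
    { toFun := fun n => γ (Ideal.Quotient.mk _ n.toAdd)
      map_one' := by simp
      map_mul' := fun x y => by rw [toAdd_mul, map_add, AddChar.map_add_eq_mul] }

theorem val_quotientChar (k : R) (γ : AddChar (R ⧸ Ideal.span {k}) Circle) (n : R) :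
    (quotientChar k γ).val (Multiplicative.ofAdd n) = γ (Ideal.Quotient.mk _ n) := rfl

/-- Orthogonality of characters on the finite group `R/(k)`, in which the class of `n` is nonzero.
-/
theorem sum_quotientChar (k n : R) [Fintype (AddChar (R ⧸ Ideal.span {k}) Circle)]
    [Finite (R ⧸ Ideal.span {k})] (h : ¬ k ∣ n) :
    ∑ γ, (quotientChar k γ).val (Multiplicative.ofAdd n) = 0 := by
  have hn : Ideal.Quotient.mk (Ideal.span {k}) n ≠ 0 := by
    rwa [Ne, Ideal.Quotient.eq_zero_iff_mem, Ideal.mem_span_singleton]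
  rw [← AddChar.sum_apply_eq_zero_iff_ne_zero.2 hn]
  exact Fintype.sum_equiv AddChar.circleEquivComplex.toEquiv _ _ fun γ => rfl

/-- Evaluation at `g`, as a continuous function on the dual group. -/
def evalMap {G : Type*} [CommGroup G] : G →* C(Dual G, ℂ) where
  toFun g := ⟨fun χ => χ.val g, Dual.continuous_val g⟩
  map_one' := by ext χ; exact χ.val_map_one
  map_mul' g h := by ext χ; exact χ.val_map_mul g h

/-- The trigonometric polynomials on the dual group. -/
def trigPoly (G : Type*) [CommGroup G] : StarSubalgebra ℂ C(Dual G, ℂ) :=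
  { (MonoidAlgebra.lift ℂ C(Dual G, ℂ) G evalMap).range with
    star_mem' := by
      rintro _ ⟨p, rfl⟩
      induction p using MonoidAlgebra.induction_on with
      | of g =>
        refine ⟨MonoidAlgebra.of ℂ G g⁻¹, ?_⟩
        ext χ
        simpa [evalMap] using χ.val_map_inv g
      | add p q hp hq =>
        rw [map_add, star_add]
        exact add_mem (S := Subalgebra ℂ C(Dual G, ℂ)) hp hq
      | smul c p hp =>
        change star (MonoidAlgebra.lift ℂ C(Dual G, ℂ) G evalMap (c • p)) ∈ _
        rw [map_smul, star_smul]
        exact Subalgebra.smul_mem _ hp _ }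

/-- Stone–Weierstrass: distinct characters differ at some group element, and evaluation there is a
trigonometric polynomial. -/
theorem trigPoly_dense (G : Type*) [CommGroup G] : (trigPoly G).topologicalClosure = ⊤ := by
  refine ContinuousMap.starSubalgebra_topologicalClosure_eq_top_of_separatesPoints _ ?_
  intro χ ψ hne
  have h : ∃ g, χ.val g ≠ ψ.val g := by
    by_contra! h
    exact hne (Dual.val_injective (funext h))
  obtain ⟨g, hg⟩ := h
  refine ⟨evalMap g, ⟨evalMap g, ⟨MonoidAlgebra.of ℂ G g, ?_⟩, rfl⟩, hg⟩
  simp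

theorem exists_trigPoly_approx {G : Type*} [CommGroup G] (F : C(Dual G, ℂ)) {ε : ℝ} (hε : 0 < ε) :
    ∃ p : G →₀ ℂ, ∀ χ : Dual G, ‖F χ - p.sum fun g c => c * χ.val g‖ ≤ ε := by
  have hF : F ∈ (trigPoly G).topologicalClosure := by rw [trigPoly_dense]; trivial
  obtain ⟨_, ⟨p, rfl⟩, hp⟩ := Metric.mem_closure_iff.1 hF ε hε
  refine ⟨p.coeff, fun χ => ?_⟩
  have h1 := (ContinuousMap.norm_coe_le_norm (F - MonoidAlgebra.lift ℂ C(Dual G, ℂ) G evalMap p) χ)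
  rw [← dist_eq_norm] at h1
  refine le_trans (le_of_eq ?_) (h1.trans hp.le)
  rw [ContinuousMap.sub_apply, MonoidAlgebra.lift_apply]
  congr 2
  simp [Finsupp.sum, evalMap]

variable [IsDomain R] [HasFiniteQuotients R]

/-- Approximate `F` uniformly by a trigonometric polynomial and average over the characters of
`R/(k)`. For a suitable `k` this removes all nonconstant terms and leaves `F` unchanged, so `F` is
uniformly close to a constant. -/
theorem eq_of_invariant_quotientChar (hR : ¬ IsField R) (F : C(Dual (Multiplicative R), ℂ))
    (hF : ∀ (k : R⁰) γ χ, F (quotientChar (k : R) γ * χ) = F χ) (χ ψ : Dual (Multiplicative R)) :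
    F χ = F ψ := by
  classical
  have key : ∀ ε > 0, ∃ c : ℂ, ∀ χ, ‖F χ - c‖ ≤ ε := by
    intro ε hε
    obtain ⟨p, hp⟩ := exists_trigPoly_approx F hε
    obtain ⟨r, hr0, hr⟩ := Ring.exists_not_isUnit_of_not_isField hR
    let N : Finset (Multiplicative R) := p.support.erase 1
    -- If `k` divided some `n` in `N`, then `n * r` would divide `n`, making `r` a unit. The factor
    -- `r` is where `R` not being a field enters.
    let k : R := r * ∏ n ∈ N, n.toAdd
    have hk : k ∈ R⁰ := by
      refine mem_nonZeroDivisors_of_ne_zero (mul_ne_zero hr0 (Finset.prod_ne_zero_iff.2 ?_))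
      intro n hn
      exact fun h => (Finset.ne_of_mem_erase hn) (toAdd_eq_zero.1 h)
    have hdvd : ∀ n ∈ N, ¬ k ∣ n.toAdd := by
      intro n hn hd
      have hn0 : n.toAdd ≠ 0 := fun h => (Finset.ne_of_mem_erase hn) (toAdd_eq_zero.1 h)
      have h1 : n.toAdd * r ∣ n.toAdd * 1 := by
        rw [mul_one]
        refine dvd_trans ?_ hd
        rw [mul_comm]
        exact mul_dvd_mul_left r (Finset.dvd_prod_of_mem _ hn)
      exact hr (isUnit_of_dvd_one ((mul_dvd_mul_iff_left hn0).1 h1))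
    have hfin : Finite (R ⧸ Ideal.span {k}) :=
      HasFiniteQuotients.finite_quotient k (nonZeroDivisors.ne_zero hk)
    let _ : Fintype (AddChar (R ⧸ Ideal.span {k}) Circle) :=
      Fintype.ofEquiv _ AddChar.circleEquivComplex.toEquiv.symm
    -- The constant is the coefficient of `p` at the neutral element, that is at `0` in `R`: it is
    -- the only one surviving the average, and it does not depend on `χ`.
    refine ⟨p 1, fun χ => ?_⟩
    set M := Fintype.card (AddChar (R ⧸ Ideal.span {k}) Circle) with hM
    have hM0 : 0 < (M : ℝ) := Nat.cast_pos.2 Fintype.card_pos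
    have hsum : ∑ γ, (p.sum fun g c => c * (quotientChar k γ * χ).val g) = M * p 1 := by
      simp only [Finsupp.sum]
      rw [Finset.sum_comm]
      have h0 : ∀ g ∈ N, ∑ γ, p g * (quotientChar k γ * χ).val g = 0 := by
        intro g hg
        simp only [Dual.val_mul_apply]
        rw [← Finset.mul_sum, ← Finset.sum_mul]
        have := sum_quotientChar k g.toAdd (hdvd g hg)
        rw [ofAdd_toAdd] at this
        rw [this, zero_mul, mul_zero]
      by_cases h1 : (1 : Multiplicative R) ∈ p.support
      · rw [← Finset.add_sum_erase _ _ h1, Finset.sum_eq_zero h0]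
        simp [hM]
      · rw [Finsupp.notMem_support_iff.1 h1, mul_zero, ← Finset.erase_eq_of_notMem h1]
        exact Finset.sum_eq_zero h0
    have h2 : M * (F χ - p 1) = ∑ γ, (F (quotientChar k γ * χ) -
        p.sum fun g c => c * (quotientChar k γ * χ).val g) := by
      rw [Finset.sum_sub_distrib, hsum, mul_sub]
      congr 1
      rw [Finset.sum_congr rfl fun γ _ => hF ⟨k, hk⟩ γ χ]
      simp [hM]
    have h3 : (M : ℝ) * ‖F χ - p 1‖ ≤ M * ε := by
      rw [← Complex.norm_natCast, ← norm_mul, h2, Complex.norm_natCast]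
      refine (norm_sum_le_of_le _ fun γ _ => hp _).trans ?_
      simp [hM]
    exact le_of_mul_le_mul_left h3 hM0
  refine eq_of_forall_dist_le fun ε hε => ?_
  obtain ⟨c, hc⟩ := key (ε / 2) (half_pos hε)
  calc dist (F χ) (F ψ) ≤ dist (F χ) c + dist (F ψ) c := dist_triangle_right _ _ _
    _ ≤ ε / 2 + ε / 2 := by rw [dist_eq_norm, dist_eq_norm]; exact add_le_add (hc χ) (hc ψ)
    _ = ε := add_halves ε

end Invariant

/-! ### Unitaries implementing finite characters -/

section Implement

variable {R : Type*} [CommRing R] [IsDomain R] [HasFiniteQuotients R]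

/-- The unitary of `𝔇[R]` with values `γ(c)` on the projections `u^c e_k u^{-c}`. -/
def charUnitary (k : R⁰) (γ : AddChar (R ⧸ Ideal.span {(k : R)}) Circle) : Alg R :=
  ∑ c, (γ c : ℂ) • proj k (Quotient.out c)

theorem proj_mul_charUnitary (k : R⁰) (γ : AddChar (R ⧸ Ideal.span {(k : R)}) Circle)
    (c : R ⧸ Ideal.span {(k : R)}) :
    proj k (Quotient.out c) * charUnitary k γ = (γ c : ℂ) • proj k (Quotient.out c) := by
  rw [charUnitary, Finset.mul_sum, Finset.sum_eq_single c]
  · rw [mul_smul_comm, proj_mul_self]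
  · intro d _ hd
    rw [mul_smul_comm, proj_mul_proj_of_not_dvd, smul_zero]
    rw [← Ideal.mem_span_singleton, ← Ideal.Quotient.eq]
    intro h
    refine hd.symm ?_
    rwa [← Quotient.out_eq c, ← Quotient.out_eq d]
  · simp

theorem star_charUnitary (k : R⁰) (γ : AddChar (R ⧸ Ideal.span {(k : R)}) Circle) :
    star (charUnitary k γ) = ∑ c, star (γ c : ℂ) • proj k (Quotient.out c) := by
  simp [charUnitary, star_sum, star_proj]

theorem star_charUnitary_mul_self (k : R⁰) (γ : AddChar (R ⧸ Ideal.span {(k : R)}) Circle) :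
    star (charUnitary k γ) * charUnitary k γ = 1 := by
  rw [star_charUnitary, Finset.sum_mul, ← sum_proj k]
  refine Finset.sum_congr rfl fun c _ => ?_
  rw [smul_mul_assoc, proj_mul_charUnitary, smul_smul, Complex.star_def, ← Circle.coe_inv_eq_conj,
    ← Circle.coe_mul, inv_mul_cancel, Circle.coe_one, one_smul]

theorem commute_charUnitary (k m : R⁰) (γ : AddChar (R ⧸ Ideal.span {(k : R)}) Circle) (n : R) :
    Commute (charUnitary k γ) (proj m n) :=
  Commute.sum_left _ _ _ fun _ _ => (commute_proj _ _ _ _).smul_left _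

theorem charUnitary_mem_unitary (k : R⁰) (γ : AddChar (R ⧸ Ideal.span {(k : R)}) Circle) :
    charUnitary k γ ∈ unitary (Alg R) := by
  refine Unitary.mem_iff.2 ⟨star_charUnitary_mul_self k γ, ?_⟩
  have h : Commute (charUnitary k γ) (star (charUnitary k γ)) := by
    rw [star_charUnitary]
    exact Commute.sum_right _ _ _ fun _ _ => (commute_charUnitary _ _ _ _).smul_right _
  rw [h.eq, star_charUnitary_mul_self]

/-- Moving `u^n` to the left through the projections shifts the class `c` to `c - n`, and reindexing
the sum produces the factor `γ(n)`. -/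
theorem charUnitary_mul_u (k : R⁰) (γ : AddChar (R ⧸ Ideal.span {(k : R)}) Circle) (n : R) :
    charUnitary k γ * u n =
      (quotientChar (k : R) γ).val (Multiplicative.ofAdd n) • (u n * charUnitary k γ) := by
  have h : ∀ c : R ⧸ Ideal.span {(k : R)}, proj k (Quotient.out c - n) =
      proj k (Quotient.out (c - Ideal.Quotient.mk _ n)) := by
    intro c
    rw [← proj_out_mk, map_sub]
    congr 3
    exact Quotient.out_eq c
  rw [val_quotientChar, charUnitary, Finset.sum_mul, Finset.mul_sum, Finset.smul_sum]
  refine Fintype.sum_equiv (Equiv.subRight (Ideal.Quotient.mk (Ideal.span {(k : R)}) n)) _ _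
    fun c => ?_
  rw [Equiv.subRight_apply, mul_smul_comm, smul_smul, ← Circle.coe_mul, ← AddChar.map_add_eq_mul,
    add_sub_cancel, smul_mul_assoc, proj_mul_u, h]

end Implement

/-! ### The action of the dual of `(R, +)` -/

section AddAction

variable {R : Type*} [CommRing R]

theorem isClosed_coreAlg : IsClosed (coreAlg R : Set (Alg R)) :=
  StarSubalgebra.isClosed_topologicalClosure _

theorem isClosed_diagAlg : IsClosed (diagAlg R : Set (Alg R)) :=
  StarSubalgebra.isClosed_topologicalClosure _

attribute [local instance] isClosed_coreAlg

/-- The `*`-homomorphism from the free `*`-algebra with `s_m ↦ e_m` and `u^n ↦ χ(n) u^n`. -/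
def coreEval (χ : Dual (Multiplicative R)) : Pre R →ₐ[ℂ] coreAlg R :=
  evalPre coreE (fun n => χ.val (Multiplicative.ofAdd n) • coreU n)

theorem coreEval_star (χ : Dual (Multiplicative R)) (a : Pre R) :
    coreEval χ (star a) = star (coreEval χ a) := evalPre_star _ _ a

theorem coreEval_preS (χ : Dual (Multiplicative R)) (m : R⁰) :
    coreEval χ (preS m) = coreE m := by
  rw [coreEval, preS, FreeStarAlg.gen, evalPre_letter]; rfl

theorem coreEval_preU (χ : Dual (Multiplicative R)) (n : R) :
    coreEval χ (preU n) = χ.val (Multiplicative.ofAdd n) • coreU n := by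
  rw [coreEval, preU, FreeStarAlg.gen, evalPre_letter]; rfl

/-- For the trivial character the range contains all `*`-polynomials in the `e_m` and `u^n`. This
lets maps on the core be defined and compared on the free `*`-algebra. -/
theorem denseRange_coreEval : DenseRange (coreEval (1 : Dual (Multiplicative R))) := by
  have hsub : ∀ x ∈ StarAlgebra.adjoin ℂ (Set.range (e (R := R)) ∪ Set.range (u (R := R))),
      ∃ a, (coreEval (1 : Dual (Multiplicative R)) a : Alg R) = x := by
    intro x hx
    induction hx using StarAlgebra.adjoin_induction with
    | mem x hx =>
      rcases hx with ⟨m, rfl⟩ | ⟨n, rfl⟩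
      · exact ⟨preS m, by rw [coreEval_preS]; rfl⟩
      · exact ⟨preU n, by rw [coreEval_preU, Dual.val_one_apply, one_smul]; rfl⟩
    | algebraMap c => exact ⟨algebraMap ℂ _ c, by rw [AlgHom.commutes]; rfl⟩
    | add x y _ _ hx hy =>
      obtain ⟨⟨a, rfl⟩, b, rfl⟩ := And.intro hx hy
      exact ⟨a + b, by rw [map_add]; rfl⟩
    | mul x y _ _ hx hy =>
      obtain ⟨⟨a, rfl⟩, b, rfl⟩ := And.intro hx hy
      exact ⟨a * b, by rw [map_mul]; rfl⟩
    | star x _ hx =>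
      obtain ⟨a, rfl⟩ := hx
      exact ⟨star a, by rw [coreEval_star]; rfl⟩
  intro y
  rw [Topology.IsEmbedding.subtypeVal.closure_eq_preimage_closure_image]
  refine closure_mono ?_ y.2
  intro x hx
  obtain ⟨a, ha⟩ := hsub x hx
  exact ⟨_, ⟨a, rfl⟩, ha⟩

theorem continuous_coreEval (a : Pre R) :
    Continuous fun χ : Dual (Multiplicative R) => coreEval χ a := by
  refine continuous_evalPre (fun _ => ?_) (fun n => ?_) a
  · exact continuous_const
  · exact (Dual.continuous_val (Multiplicative.ofAdd n)).smul continuous_const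

variable [IsDomain R] [HasFiniteQuotients R]

/-- Conjugation by the unitary fixes each `e_m` and multiplies `u^n` by the finite character, so it
carries one twisted evaluation to the other. -/
theorem coreEval_mul_charUnitary (k : R⁰) (γ : AddChar (R ⧸ Ideal.span {(k : R)}) Circle)
    (χ : Dual (Multiplicative R)) (a : Pre R) :
    (charUnitary k γ * coreEval χ a : Alg R) =
      coreEval (quotientChar (k : R) γ * χ) a * charUnitary k γ := by
  induction a using FreeStarAlg.induction_on with
  | h_scalar c =>
    rw [AlgHom.commutes, AlgHom.commutes]
    exact (Algebra.commutes c _).symm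
  | h_letter x b =>
    have hstar : FreeStarAlg.letter x true = star (FreeStarAlg.gen x) := by
      rw [FreeStarAlg.gen, FreeStarAlg.star_letter]; rfl
    rcases x with m | n
    · have he : charUnitary k γ * e m = e m * charUnitary k γ := by
        rw [← proj_zero]
        exact commute_charUnitary k m γ 0
      cases b with
      | false =>
        change charUnitary k γ * (coreEval χ (preS m) : Alg R) =
          coreEval (quotientChar (k : R) γ * χ) (preS m) * charUnitary k γ
        rw [coreEval_preS, coreEval_preS]
        exact he
      | true =>
        rw [hstar]
        change charUnitary k γ * (coreEval χ (star (preS m)) : Alg R) =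
          coreEval (quotientChar (k : R) γ * χ) (star (preS m)) * charUnitary k γ
        rw [coreEval_star, coreEval_star, coreEval_preS, coreEval_preS]
        change charUnitary k γ * star (e m) = star (e m) * charUnitary k γ
        rw [star_e, he]
    · cases b with
      | false =>
        change charUnitary k γ * (coreEval χ (preU n) : Alg R) =
          coreEval (quotientChar (k : R) γ * χ) (preU n) * charUnitary k γ
        rw [coreEval_preU, coreEval_preU, Dual.val_mul_apply]
        change charUnitary k γ * (χ.val (Multiplicative.ofAdd n) • u n) =
          (_ * χ.val (Multiplicative.ofAdd n)) • u n * charUnitary k γ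
        rw [mul_smul_comm, charUnitary_mul_u, smul_smul, mul_comm, smul_mul_assoc]
      | true =>
        rw [hstar]
        change charUnitary k γ * (coreEval χ (star (preU n)) : Alg R) =
          coreEval (quotientChar (k : R) γ * χ) (star (preU n)) * charUnitary k γ
        rw [coreEval_star, coreEval_star, coreEval_preU, coreEval_preU, Dual.val_mul_apply]
        change charUnitary k γ * star (χ.val (Multiplicative.ofAdd n) • u n) =
          star ((_ * χ.val (Multiplicative.ofAdd n)) • u n) * charUnitary k γ
        rw [star_smul, star_smul, star_u, mul_smul_comm, charUnitary_mul_u, ofAdd_neg,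
          Dual.val_map_inv, smul_smul, smul_mul_assoc, star_mul]
  | h_add a b ha hb =>
    rw [map_add, map_add]
    change charUnitary k γ * ((coreEval χ a : Alg R) + coreEval χ b) = (_ + _) * _
    rw [mul_add, add_mul, ha, hb]
  | h_mul a b ha hb =>
    rw [map_mul, map_mul]
    change charUnitary k γ * ((coreEval χ a : Alg R) * coreEval χ b) = (_ * _) * _
    rw [← mul_assoc, ha, mul_assoc, hb, mul_assoc]

theorem norm_coreEval_quotientChar (k : R⁰) (γ : AddChar (R ⧸ Ideal.span {(k : R)}) Circle)
    (χ : Dual (Multiplicative R)) (a : Pre R) :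
    ‖coreEval (quotientChar (k : R) γ * χ) a‖ = ‖coreEval χ a‖ := by
  have h := congrArg norm (coreEval_mul_charUnitary k γ χ a)
  rw [CStarRing.norm_mem_unitary_mul _ (charUnitary_mem_unitary k γ),
    CStarRing.norm_mul_mem_unitary _ (charUnitary_mem_unitary k γ)] at h
  exact h.symm

/-- For fixed `a` the norm is continuous in `χ` and, by unitary conjugation, invariant under finite
characters, hence constant. In particular `coreEval χ` vanishes wherever `coreEval 1` does, which
makes the twist well defined on the core. -/
theorem norm_coreEval (hR : ¬ IsField R) (χ : Dual (Multiplicative R)) (a : Pre R) :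
    ‖coreEval χ a‖ = ‖coreEval (1 : Dual (Multiplicative R)) a‖ := by
  let F : C(Dual (Multiplicative R), ℂ) :=
    ⟨fun χ => (‖coreEval χ a‖ : ℝ), Complex.continuous_ofReal.comp (continuous_coreEval a).norm⟩
  have h := eq_of_invariant_quotientChar hR F (fun k γ χ =>
    congrArg Complex.ofReal (norm_coreEval_quotientChar k γ χ a)) χ 1
  exact Complex.ofReal_injective h

/-- The continuous linear extension of `coreEval χ`. -/
def addTwistLin (χ : Dual (Multiplicative R)) : coreAlg R →L[ℂ] coreAlg R :=
  (coreEval χ).toLinearMap.extendOfNorm (coreEval (1 : Dual (Multiplicative R))).toLinearMap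

theorem addTwistLin_coreEval (hR : ¬ IsField R) (χ : Dual (Multiplicative R)) (a : Pre R) :
    addTwistLin χ (coreEval 1 a) = coreEval χ a :=
  LinearMap.extendOfNorm_eq (f := (coreEval χ).toLinearMap)
    (e := (coreEval (1 : Dual (Multiplicative R))).toLinearMap) denseRange_coreEval
    ⟨1, fun x => by rw [one_mul]; exact (norm_coreEval hR χ x).le⟩ a

/-- The endomorphism of `C^*({e_m} ∪ {u^n})` that multiplies `u^n` by `χ(n)`. -/
def addTwist (hR : ¬ IsField R) (χ : Dual (Multiplicative R)) : coreAlg R →⋆ₐ[ℂ] coreAlg R where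
  toFun := addTwistLin χ
  map_one' := by
    have h := addTwistLin_coreEval hR χ 1
    rwa [map_one (coreEval _), map_one (coreEval _)] at h
  map_zero' := map_zero _
  map_add' := map_add _
  map_mul' x y := by
    refine denseRange_coreEval.induction_on₂
      (p := fun x y => addTwistLin χ (x * y) = addTwistLin χ x * addTwistLin χ y) ?_ ?_ x y
    · exact isClosed_eq (by fun_prop) (by fun_prop)
    · intro a b
      rw [← map_mul, addTwistLin_coreEval hR, addTwistLin_coreEval hR, addTwistLin_coreEval hR,
        map_mul]
  commutes' c := by
    have h := addTwistLin_coreEval hR χ (algebraMap ℂ _ c)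
    rwa [AlgHom.commutes, AlgHom.commutes] at h
  map_star' x := by
    refine denseRange_coreEval.induction_on
      (p := fun x => addTwistLin χ (star x) = star (addTwistLin χ x)) x ?_ ?_
    · exact isClosed_eq (by fun_prop) (by fun_prop)
    · intro a
      rw [← coreEval_star, addTwistLin_coreEval hR, addTwistLin_coreEval hR, coreEval_star]

theorem addTwist_coreEval (hR : ¬ IsField R) (χ : Dual (Multiplicative R)) (a : Pre R) :
    addTwist hR χ (coreEval 1 a) = coreEval χ a := addTwistLin_coreEval hR χ a

theorem continuous_addTwist (hR : ¬ IsField R) (χ : Dual (Multiplicative R)) :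
    Continuous (addTwist hR χ) := (addTwistLin χ).continuous

@[simp]
theorem addTwist_coreE (hR : ¬ IsField R) (χ : Dual (Multiplicative R)) (m : R⁰) :
    addTwist hR χ (coreE m) = coreE m := by
  have h := addTwist_coreEval hR χ (preS m)
  rwa [coreEval_preS, coreEval_preS] at h

@[simp]
theorem addTwist_coreU (hR : ¬ IsField R) (χ : Dual (Multiplicative R)) (n : R) :
    addTwist hR χ (coreU n) = χ.val (Multiplicative.ofAdd n) • coreU n := by
  have h := addTwist_coreEval hR χ (preU n)
  rwa [coreEval_preU, coreEval_preU, Dual.val_one_apply, one_smul] at h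

theorem addTwist_coreEval_mul (hR : ¬ IsField R) (χ ψ : Dual (Multiplicative R)) (a : Pre R) :
    addTwist hR χ (coreEval ψ a) = coreEval (χ * ψ) a := by
  rw [coreEval, map_evalPre, coreEval]
  simp only [map_smul, addTwist_coreE, addTwist_coreU, smul_smul, Dual.val_mul_apply, mul_comm]

/-- The action of the dual of `(R, +)` on `C^*({e_m} ∪ {u^n})`. -/
def addAction (hR : ¬ IsField R) : Dual (Multiplicative R) →* (coreAlg R ≃⋆ₐ[ℂ] coreAlg R) :=
  actionOfHoms (addTwist hR)
    (fun x => by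
      refine denseRange_coreEval.induction_on (p := fun x => addTwist hR 1 x = x) x ?_ ?_
      · exact isClosed_eq (continuous_addTwist hR 1) continuous_id
      · exact addTwist_coreEval hR 1)
    (fun χ ψ x => by
      refine denseRange_coreEval.induction_on
        (p := fun x => addTwist hR (χ * ψ) x = addTwist hR χ (addTwist hR ψ x)) x ?_ ?_
      · exact isClosed_eq (continuous_addTwist hR _)
          ((continuous_addTwist hR χ).comp (continuous_addTwist hR ψ))
      · intro a
        rw [addTwist_coreEval, addTwist_coreEval, addTwist_coreEval_mul])

theorem isAddDualAction_addAction (hR : ¬ IsField R) : IsAddDualAction (addAction hR) where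
  apply_e := addTwist_coreE hR
  apply_u := addTwist_coreU hR
  continuous := by
    refine continuous_apply_of_dense (fun χ x => addTwist hR χ x) (fun χ a b => ?_)
      denseRange_coreEval ?_
    · rw [← map_sub]
      exact norm_starAlgHom_le (addTwist hR χ) (a - b)
    · rintro _ ⟨a, rfl⟩
      simp only [addTwist_coreEval]
      exact continuous_coreEval a

end AddAction

/-! ### Averages -/

section Average

variable {G A B : Type*} [CommGroup G] [NormedAddCommGroup A] [NormedSpace ℂ A]
  [NormedAddCommGroup B] [NormedSpace ℂ B]

/-- The average of a point-norm continuous family of linear contractions over the dual group. -/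
def average (f : Dual G → A →ₗ[ℂ] B) (hf : ∀ x, Continuous fun χ => f χ x)
    (hle : ∀ χ x, ‖f χ x‖ ≤ ‖x‖) : A →L[ℂ] B :=
  LinearMap.mkContinuous
    { toFun := fun x => ∫ χ, f χ x ∂(dualHaar G)
      map_add' := fun x y => by
        simp only [map_add]
        exact MeasureTheory.integral_add (integrable_of_continuous (hf x))
          (integrable_of_continuous (hf y))
      map_smul' := fun c x => by
        simp only [map_smul, RingHom.id_apply]
        exact MeasureTheory.integral_smul c _ } 1
    (fun x => by
      refine (MeasureTheory.norm_integral_le_of_norm_le_const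
        (Filter.Eventually.of_forall fun χ => hle χ x)).trans ?_
      simp)

variable (f : Dual G → A →ₗ[ℂ] B) (hf : ∀ x, Continuous fun χ => f χ x)
  (hle : ∀ χ x, ‖f χ x‖ ≤ ‖x‖)

theorem norm_average_le (x : A) : ‖average f hf hle x‖ ≤ ‖x‖ := by
  refine (MeasureTheory.norm_integral_le_of_norm_le_const
    (Filter.Eventually.of_forall fun χ => hle χ x)).trans ?_
  simp

end Average

/-- Restriction of the codomain to a `*`-subalgebra. -/
def codRestrictStar {E A : Type*} [NormedAddCommGroup E] [NormedSpace ℂ E] [CStarAlgebra A]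
    (D : StarSubalgebra ℂ A) (f : E →L[ℂ] A) (h : ∀ x, f x ∈ D) : E →L[ℂ] D where
  toFun x := ⟨f x, h x⟩
  map_add' x y := Subtype.ext (map_add f x y)
  map_smul' c x := Subtype.ext (map_smul f c x)
  cont := f.continuous.subtype_mk _

theorem delta_self {ι : Type*} (i : ι) : delta i i = 1 := if_pos rfl

theorem delta_of_ne {ι : Type*} {i j : ι} (h : i ≠ j) : delta i j = 0 := if_neg h

theorem delta_congr {ι κ : Type*} {i j : ι} {k l : κ} (h : i = j ↔ k = l) :
    delta i j = delta k l := by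
  by_cases hij : i = j
  · rw [delta, delta, if_pos hij, if_pos (h.1 hij)]
  · rw [delta, delta, if_neg hij, if_neg (h.not.1 hij)]

/-! ### The two averages on words and the construction of the expectation -/

section Expectation

attribute [local instance] isClosed_coreAlg

variable {R : Type*} [CommRing R] [IsDomain R] [HasFiniteQuotients R]

variable (R) in
/-- The average over the dual of `Q(R)^×`. -/
def mulAvg : Alg R →L[ℂ] Alg R :=
  average (fun φ => (mulTwist φ : Alg R →⋆ₐ[ℂ] Alg R).toAlgHom.toLinearMap)
    (isMulDualAction_mulAction (R := R)).continuous (fun φ x => norm_starAlgHom_le (mulTwist φ) x)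

theorem mulAvg_apply (x : Alg R) :
    mulAvg R x = ∫ φ, mulTwist φ x ∂(dualHaar (FractionRing R)ˣ) := rfl

theorem norm_mulAvg_le (x : Alg R) : ‖mulAvg R x‖ ≤ ‖x‖ := norm_average_le _ _ _ x

/-- The word is an eigenvector of the action with character `φ(m'/m)`, whose integral vanishes
unless `m = m'`. -/
theorem mulAvg_word (m m' k : R⁰) (a b : R) :
    mulAvg R (star (s m) * (u a * e k * u b) * s m') =
      delta m m' • (star (s m) * (u a * e k * u b) * s m') := by
  have h : ∀ φ : Dual (FractionRing R)ˣ, mulTwist φ (star (s m) * (u a * e k * u b) * s m') =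
      φ.val (toFrac m' * (toFrac m)⁻¹) • (star (s m) * (u a * e k * u b) * s m') := by
    intro φ
    simp only [map_mul, map_star, mulTwist_s, mulTwist_u, mulTwist_e, star_smul, smul_mul_assoc,
      mul_smul_comm, smul_smul]
    rw [Dual.val_map_mul, Dual.val_map_inv]
  rw [mulAvg_apply]
  simp only [h]
  rw [integral_smul_const, integral_val]
  congr 1
  refine delta_congr ?_
  rw [mul_inv_eq_one, toFrac_injective.eq_iff, eq_comm]

theorem u_mul_e_mul_u_mem_coreAlg (k : R⁰) (a b : R) : u a * e k * u b ∈ coreAlg R :=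
  (coreU a * coreE k * coreU b).2

theorem compression_mem_coreAlg (m k : R⁰) (a b : R) :
    star (s m) * (u a * e k * u b) * s m ∈ coreAlg R := by
  have h : Submodule.span ℂ {z | ∃ x y : R, m * (x + y) = a + b ∧ z = u x * e k * u y} ≤
      Subalgebra.toSubmodule (coreAlg R).toSubalgebra := by
    rw [Submodule.span_le]
    rintro _ ⟨x, y, -, rfl⟩
    exact u_mul_e_mul_u_mem_coreAlg k x y
  exact h (compression_mem_span m k a b)

theorem mulAvg_mem_coreAlg (x : Alg R) : mulAvg R x ∈ coreAlg R := by
  refine word_induction (P := fun x => mulAvg R x ∈ coreAlg R) ?_ ?_ ?_ ?_ ?_ x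
  · exact isClosed_coreAlg.preimage (mulAvg R).continuous
  · rw [map_zero]; exact zero_mem _
  · intro x y hx hy; rw [map_add]; exact add_mem hx hy
  · intro c x hx; rw [map_smul]; exact SMulMemClass.smul_mem c hx
  · intro m m' k a b
    rw [mulAvg_word]
    by_cases h : m = m'
    · subst h
      exact SMulMemClass.smul_mem _ (compression_mem_coreAlg m k a b)
    · rw [delta_of_ne h, zero_smul]
      exact zero_mem _

variable (R) in
/-- The average over the dual of `Q(R)^×`, as a map to `C^*({e_m} ∪ {u^n})`. -/
def mulAvgCore : Alg R →L[ℂ] coreAlg R := codRestrictStar _ (mulAvg R) mulAvg_mem_coreAlg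

theorem coe_mulAvgCore (x : Alg R) : (mulAvgCore R x : Alg R) = mulAvg R x := rfl

/-- The average over the dual of `(R, +)`. -/
def addAvg (hR : ¬ IsField R) : coreAlg R →L[ℂ] Alg R :=
  average (fun χ => (coreAlg R).subtype.toAlgHom.toLinearMap ∘ₗ
      (addTwist hR χ).toAlgHom.toLinearMap)
    (fun y => continuous_subtype_val.comp ((isAddDualAction_addAction hR).continuous y))
    (fun χ y => norm_starAlgHom_le (addTwist hR χ) y)

theorem addAvg_apply (hR : ¬ IsField R) (y : coreAlg R) :
    addAvg hR y = ∫ χ, (addTwist hR χ y : Alg R) ∂(dualHaar (Multiplicative R)) := rfl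

theorem norm_addAvg_le (hR : ¬ IsField R) (y : coreAlg R) : ‖addAvg hR y‖ ≤ ‖y‖ :=
  norm_average_le _ _ _ y

theorem addAvg_core (hR : ¬ IsField R) (k : R⁰) (a b : R) :
    addAvg hR (coreU a * coreE k * coreU b) = delta (a + b) 0 • (u a * e k * u b) := by
  have h : ∀ χ : Dual (Multiplicative R), (addTwist hR χ (coreU a * coreE k * coreU b) : Alg R) =
      χ.val (Multiplicative.ofAdd (a + b)) • (u a * e k * u b) := by
    intro χ
    rw [map_mul, map_mul, addTwist_coreE, addTwist_coreU, addTwist_coreU, smul_mul_assoc,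
      smul_mul_assoc, mul_smul_comm, smul_smul, ← Dual.val_map_mul, ← ofAdd_add]
    rfl
  rw [addAvg_apply]
  simp only [h]
  rw [integral_smul_const, integral_val]
  rfl

/-- The twist is not defined on `s_m`, so the compression is first expanded into terms `u^x e_k u^y`
with `m (x + y) = a + b`. Since `m ≠ 0`, the conditions `x + y = 0` and `a + b = 0` agree, and one
Kronecker symbol serves all terms. -/
theorem addAvg_compression (hR : ¬ IsField R) (m k : R⁰) (a b : R) :
    addAvg hR ⟨_, compression_mem_coreAlg m k a b⟩ =
      delta (a + b) 0 • (star (s m) * (u a * e k * u b) * s m) := by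
  have key : ∀ z ∈ Submodule.span ℂ {z | ∃ x y : R, m * (x + y) = a + b ∧ z = u x * e k * u y},
      ∀ y : coreAlg R, (y : Alg R) = z → addAvg hR y = delta (a + b) 0 • z := by
    intro z hz
    -- Carrying a lift to the core through the induction supplies an argument for `addAvg`; the lift
    -- is unique, so any other one gives the same value.
    have hz' : ∃ y : coreAlg R, (y : Alg R) = z ∧ addAvg hR y = delta (a + b) 0 • z := by
      induction hz using Submodule.span_induction with
      | mem z hz =>
        obtain ⟨x, y, hxy, rfl⟩ := hz
        refine ⟨coreU x * coreE k * coreU y, rfl, ?_⟩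
        rw [addAvg_core]
        congr 1
        refine delta_congr ?_
        rw [← hxy, mul_eq_zero, or_iff_right (nonZeroDivisors.coe_ne_zero m)]
      | zero => exact ⟨0, rfl, by simp⟩
      | add x y _ _ hx hy =>
        obtain ⟨⟨x', rfl, hx⟩, y', rfl, hy⟩ := And.intro hx hy
        exact ⟨x' + y', rfl, by rw [map_add, hx, hy, smul_add]⟩
      | smul c x _ hx =>
        obtain ⟨x', rfl, hx⟩ := hx
        exact ⟨c • x', rfl, by rw [map_smul, hx, smul_comm]⟩
    obtain ⟨y', hy', h⟩ := hz'
    intro y hy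
    rwa [show y = y' from Subtype.ext (hy.trans hy'.symm)]
  exact key _ (compression_mem_span m k a b) _ rfl

theorem compression_mem_diagAlg (m k : R⁰) (a : R) :
    star (s m) * (u a * e k * u (-a)) * s m ∈ diagAlg R := by
  have h : Submodule.span ℂ {z | ∃ x y : R, m * (x + y) = a + -a ∧ z = u x * e k * u y} ≤
      Subalgebra.toSubmodule (diagAlg R).toSubalgebra := by
    rw [Submodule.span_le]
    rintro _ ⟨x, y, hxy, rfl⟩
    rw [add_neg_cancel, mul_eq_zero, or_iff_right (nonZeroDivisors.coe_ne_zero m)] at hxy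
    rw [eq_neg_of_add_eq_zero_right hxy]
    exact StarSubalgebra.le_topologicalClosure _ (StarAlgebra.subset_adjoin ℂ _ (proj_mem k x))
  exact h (compression_mem_span m k a (-a))

/-- The double average, with values in `𝔄[R]`. -/
def doubleAvg (hR : ¬ IsField R) : Alg R →L[ℂ] Alg R := (addAvg hR).comp (mulAvgCore R)

theorem doubleAvg_apply (hR : ¬ IsField R) (x : Alg R) :
    doubleAvg hR x = addAvg hR (mulAvgCore R x) := rfl

theorem doubleAvg_word (hR : ¬ IsField R) (m m' k : R⁰) (a b : R) :
    doubleAvg hR (star (s m) * (u a * e k * u b) * s m') =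
      (delta m m' * delta (a + b) 0) • (star (s m) * (u a * e k * u b) * s m) := by
  rw [doubleAvg_apply]
  by_cases h : m = m'
  · subst h
    have h1 : mulAvgCore R (star (s m) * (u a * e k * u b) * s m) =
        ⟨_, compression_mem_coreAlg m k a b⟩ := by
      refine Subtype.ext ?_
      rw [coe_mulAvgCore, mulAvg_word, delta_self, one_smul]
    rw [h1, addAvg_compression, delta_self, one_mul]
  · have h1 : mulAvgCore R (star (s m) * (u a * e k * u b) * s m') = 0 := by
      refine Subtype.ext ?_
      rw [coe_mulAvgCore, mulAvg_word, delta_of_ne h, zero_smul]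
      rfl
    rw [h1, map_zero, delta_of_ne h, zero_mul, zero_smul]

theorem doubleAvg_mem_diagAlg (hR : ¬ IsField R) (x : Alg R) : doubleAvg hR x ∈ diagAlg R := by
  refine word_induction (P := fun x => doubleAvg hR x ∈ diagAlg R) ?_ ?_ ?_ ?_ ?_ x
  · exact isClosed_diagAlg.preimage (doubleAvg hR).continuous
  · rw [map_zero]; exact zero_mem _
  · intro x y hx hy; rw [map_add]; exact add_mem hx hy
  · intro c x hx; rw [map_smul]; exact SMulMemClass.smul_mem c hx
  · intro m m' k a b
    rw [doubleAvg_word]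
    by_cases h : a + b = 0
    · rw [eq_neg_of_add_eq_zero_right h]
      exact SMulMemClass.smul_mem _ (compression_mem_diagAlg m k a)
    · rw [delta_of_ne h, mul_zero, zero_smul]
      exact zero_mem _

/-- The conditional expectation onto `𝔇[R]`. -/
def expectation (hR : ¬ IsField R) : Alg R →L[ℂ] diagAlg R :=
  codRestrictStar _ (doubleAvg hR) (doubleAvg_mem_diagAlg hR)

theorem coe_expectation (hR : ¬ IsField R) (x : Alg R) :
    (expectation hR x : Alg R) = addAvg hR (mulAvgCore R x) := rfl

/-! ### Invariance of `𝔇[R]` -/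

theorem mulTwist_of_mem_diagAlg (φ : Dual (FractionRing R)ˣ) {d : Alg R} (hd : d ∈ diagAlg R) :
    mulTwist φ d = d := by
  have h : diagAlg R ≤ StarAlgHom.equalizer (mulTwist φ) (StarAlgHom.id ℂ (Alg R)) := by
    refine StarSubalgebra.topologicalClosure_minimal (StarAlgebra.adjoin_le ?_)
      (isClosed_eq (continuous_starAlgHom _) continuous_id)
    rintro _ ⟨m, n, rfl⟩
    change mulTwist φ (u n * e m * u (-n)) = u n * e m * u (-n)
    simp
  exact h hd

/-- The fixed-point algebra of the twist is closed in the core, hence its image in `𝔄[R]` is closed;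
it contains `P` because the factors `χ(n)` and `χ(-n)` cancel. Membership in the core and invariance
thus come together. -/
theorem exists_addTwist_of_mem_diagAlg (hR : ¬ IsField R) (χ : Dual (Multiplicative R)) {d : Alg R}
    (hd : d ∈ diagAlg R) : ∃ y : coreAlg R, addTwist hR χ y = y ∧ (y : Alg R) = d := by
  have h : diagAlg R ≤ (StarAlgHom.equalizer (addTwist hR χ) (StarAlgHom.id ℂ (coreAlg R))).map
      (coreAlg R).subtype := by
    refine StarSubalgebra.topologicalClosure_minimal (StarAlgebra.adjoin_le ?_) ?_
    · rintro _ ⟨m, n, rfl⟩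
      refine ⟨coreU n * coreE m * coreU (-n), ?_, rfl⟩
      change addTwist hR χ (coreU n * coreE m * coreU (-n)) = coreU n * coreE m * coreU (-n)
      rw [map_mul, map_mul, addTwist_coreE, addTwist_coreU, addTwist_coreU, smul_mul_assoc,
        smul_mul_assoc, mul_smul_comm, smul_smul, ← Dual.val_map_mul, ← ofAdd_add, add_neg_cancel,
        ofAdd_zero, Dual.val_map_one, one_smul]
    · refine isClosed_coreAlg.isClosedEmbedding_subtypeVal.isClosedMap _ ?_
      exact isClosed_eq (continuous_addTwist hR χ) continuous_id
  exact h hd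

theorem diagAlg_le_coreAlg (hR : ¬ IsField R) : diagAlg R ≤ coreAlg R := by
  intro d hd
  obtain ⟨y, -, rfl⟩ := exists_addTwist_of_mem_diagAlg hR 1 hd
  exact y.2

theorem addTwist_of_mem_diagAlg (hR : ¬ IsField R) (χ : Dual (Multiplicative R)) {d : coreAlg R}
    (hd : (d : Alg R) ∈ diagAlg R) : addTwist hR χ d = d := by
  obtain ⟨y, hy, hyd⟩ := exists_addTwist_of_mem_diagAlg hR χ hd
  rwa [← show y = d from Subtype.ext hyd]

end Expectation

/-! ### Properties of the expectation -/

section Properties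

attribute [local instance] isClosed_coreAlg

variable {R : Type*} [CommRing R] [IsDomain R] [HasFiniteQuotients R]

theorem continuous_mulTwist_apply (x : Alg R) :
    Continuous fun φ : Dual (FractionRing R)ˣ => mulTwist φ x :=
  (isMulDualAction_mulAction (R := R)).continuous x

theorem continuous_addTwist_apply (hR : ¬ IsField R) (y : coreAlg R) :
    Continuous fun χ : Dual (Multiplicative R) => (addTwist hR χ y : Alg R) :=
  continuous_subtype_val.comp ((isAddDualAction_addAction hR).continuous y)

theorem mulTwist_one (x : Alg R) : mulTwist 1 x = x :=
  congrArg (fun f : Alg R ≃⋆ₐ[ℂ] Alg R => f x) (map_one (mulAction R))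

theorem addTwist_one (hR : ¬ IsField R) (y : coreAlg R) : addTwist hR 1 y = y :=
  congrArg (fun f : coreAlg R ≃⋆ₐ[ℂ] coreAlg R => f y) (map_one (addAction hR))

theorem norm_expectation_le (hR : ¬ IsField R) (x : Alg R) : ‖expectation hR x‖ ≤ ‖x‖ :=
  (norm_addAvg_le hR (mulAvgCore R x)).trans (norm_mulAvg_le x)

theorem mulAvgCore_diag_mul (d : coreAlg R) (hd : (d : Alg R) ∈ diagAlg R) (x : Alg R) :
    mulAvgCore R (d * x) = d * mulAvgCore R x := by
  refine Subtype.ext ?_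
  change mulAvg R (d * x) = d * mulAvg R x
  rw [mulAvg_apply, mulAvg_apply]
  simp only [map_mul, mulTwist_of_mem_diagAlg _ hd]
  exact integral_const_mul_of_integrable
    (integrable_of_continuous (continuous_mulTwist_apply x))

theorem mulAvgCore_mul_diag (d : coreAlg R) (hd : (d : Alg R) ∈ diagAlg R) (x : Alg R) :
    mulAvgCore R (x * d) = mulAvgCore R x * d := by
  refine Subtype.ext ?_
  change mulAvg R (x * d) = mulAvg R x * d
  rw [mulAvg_apply, mulAvg_apply]
  simp only [map_mul, mulTwist_of_mem_diagAlg _ hd]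
  exact integral_mul_const_of_integrable
    (integrable_of_continuous (continuous_mulTwist_apply x))

theorem addAvg_diag_mul (hR : ¬ IsField R) (d : coreAlg R) (hd : (d : Alg R) ∈ diagAlg R)
    (y : coreAlg R) : addAvg hR (d * y) = d * addAvg hR y := by
  rw [addAvg_apply, addAvg_apply]
  simp only [map_mul, addTwist_of_mem_diagAlg hR _ hd]
  exact integral_const_mul_of_integrable
    (integrable_of_continuous (continuous_addTwist_apply hR y))

theorem addAvg_mul_diag (hR : ¬ IsField R) (d : coreAlg R) (hd : (d : Alg R) ∈ diagAlg R)
    (y : coreAlg R) : addAvg hR (y * d) = addAvg hR y * d := by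
  rw [addAvg_apply, addAvg_apply]
  simp only [map_mul, addTwist_of_mem_diagAlg hR _ hd]
  exact integral_mul_const_of_integrable
    (integrable_of_continuous (continuous_addTwist_apply hR y))

theorem expectation_left_mul (hR : ¬ IsField R) (d : diagAlg R) (x : Alg R) :
    expectation hR (d * x) = d * expectation hR x := by
  refine Subtype.ext ?_
  change addAvg hR (mulAvgCore R (d * x)) = d * addAvg hR (mulAvgCore R x)
  have h := mulAvgCore_diag_mul ⟨d, diagAlg_le_coreAlg hR d.2⟩ d.2 x
  exact (congrArg (addAvg hR) h).trans (addAvg_diag_mul hR _ d.2 _)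

theorem expectation_right_mul (hR : ¬ IsField R) (x : Alg R) (d : diagAlg R) :
    expectation hR (x * d) = expectation hR x * d := by
  refine Subtype.ext ?_
  change addAvg hR (mulAvgCore R (x * d)) = addAvg hR (mulAvgCore R x) * d
  have h := mulAvgCore_mul_diag ⟨d, diagAlg_le_coreAlg hR d.2⟩ d.2 x
  exact (congrArg (addAvg hR) h).trans (addAvg_mul_diag hR _ d.2 _)

theorem expectation_coe (hR : ¬ IsField R) (d : diagAlg R) : expectation hR d = d := by
  have h1 : mulAvgCore R d = ⟨d, diagAlg_le_coreAlg hR d.2⟩ := by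
    refine Subtype.ext ?_
    change mulAvg R d = d
    rw [mulAvg_apply]
    simp only [mulTwist_of_mem_diagAlg _ d.2]
    simp
  refine Subtype.ext ?_
  rw [coe_expectation, h1, addAvg_apply]
  simp only [addTwist_of_mem_diagAlg hR _ (d := ⟨d, diagAlg_le_coreAlg hR d.2⟩) d.2]
  simp

/-- The twists of the second average act only on the core, so the positivity of the first average
must be witnessed by an element of the core. -/
theorem exists_mulAvgCore_eq [PartialOrder (Alg R)] [StarOrderedRing (Alg R)] (x : Alg R) :
    ∃ y : coreAlg R, mulAvgCore R (star x * x) = star y * y := by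
  refine exists_star_mul_self_of_nonneg (coreAlg R) isClosed_coreAlg _ ?_
  rw [coe_mulAvgCore, mulAvg_apply]
  refine MeasureTheory.integral_nonneg fun φ => ?_
  simp only [map_mul, map_star]
  exact star_mul_self_nonneg _

theorem addTwist_star_mul_self_nonneg [PartialOrder (Alg R)] [StarOrderedRing (Alg R)]
    (hR : ¬ IsField R) (χ : Dual (Multiplicative R)) (y : coreAlg R) :
    0 ≤ (addTwist hR χ (star y * y) : Alg R) := by
  rw [map_mul, map_star]
  exact star_mul_self_nonneg (addTwist hR χ y : Alg R)

theorem isCondExp_expectation (hR : ¬ IsField R) : IsCondExp (diagAlg R) (expectation hR) where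
  contractive := norm_expectation_le hR
  positive x := by
    let _ := CStarAlgebra.spectralOrder (Alg R)
    let _ := CStarAlgebra.spectralOrderedRing (Alg R)
    refine exists_star_mul_self_of_nonneg (diagAlg R) isClosed_diagAlg _ ?_
    obtain ⟨y, hy⟩ := exists_mulAvgCore_eq x
    rw [coe_expectation, hy, addAvg_apply]
    exact MeasureTheory.integral_nonneg fun χ => addTwist_star_mul_self_nonneg hR χ y
  apply_coe := expectation_coe hR
  left_mul := expectation_left_mul hR
  right_mul := expectation_right_mul hR

/-- A vanishing integral of a continuous positive function forces the value at the trivial character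
to vanish. Applied first to the additive and then to the multiplicative average, this yields `x^* x
= 0`. -/
theorem isFaithful_expectation (hR : ¬ IsField R) : IsFaithful (expectation hR) := by
  intro x hx
  let _ := CStarAlgebra.spectralOrder (Alg R)
  let _ := CStarAlgebra.spectralOrderedRing (Alg R)
  obtain ⟨y, hy⟩ := exists_mulAvgCore_eq x
  have h0 : addAvg hR (mulAvgCore R (star x * x)) = 0 := congrArg Subtype.val hx
  rw [hy, addAvg_apply] at h0
  have h1 := eq_zero_of_integral_eq_zero (continuous_addTwist_apply hR (star y * y))
    (fun χ => addTwist_star_mul_self_nonneg hR χ y) h0 1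
  rw [addTwist_one, ← hy, coe_mulAvgCore, mulAvg_apply] at h1
  have h2 := eq_zero_of_integral_eq_zero (continuous_mulTwist_apply (star x * x))
    (fun φ => by rw [map_mul, map_star]; exact star_mul_self_nonneg _) h1 1
  rw [mulTwist_one] at h2
  exact (CStarRing.star_mul_self_eq_zero_iff x).1 h2

theorem standardFormula_expectation (hR : ¬ IsField R) : StandardFormula (expectation hR) := by
  rintro m m' n n' _ ⟨k, a, rfl⟩
  have hw : ∀ (m' : R⁰) (n' : R), star (s m) * u n * (u a * e k * u (-a)) * u (-n') * s m' =
      star (s m) * (u (n + a) * e k * u (-a + -n')) * s m' := by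
    intro m' n'
    rw [← u_mul_u, ← u_mul_u]
    simp only [mul_assoc]
  -- The conjugating exponents `a` and `-a` of `f` cancel, so the total degree of the word is `n -
  -- n'`.
  have hd : delta (n + a + (-a + -n')) 0 = delta n n' := by
    refine delta_congr ?_
    rw [show n + a + (-a + -n') = n - n' by ring, sub_eq_zero]
  change doubleAvg hR _ = _
  rw [hw, hw, doubleAvg_word, hd]
  by_cases h : n = n'
  · rw [h]
  · rw [delta_of_ne h, mul_zero, zero_smul, zero_smul]

/-- Every spanning word is of the form covered by the formula, with `f = e_k` and `n' = -b`, and the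
words span a dense subspace. -/
theorem StandardFormula.ext {Θ Ψ : Alg R →L[ℂ] diagAlg R} (hΘ : StandardFormula Θ)
    (hΨ : StandardFormula Ψ) : Θ = Ψ := by
  ext x : 1
  refine word_induction (P := fun x => Θ x = Ψ x) (isClosed_eq Θ.continuous Ψ.continuous)
    (by simp) (fun x y hx hy => by rw [map_add, map_add, hx, hy])
    (fun c x hx => by rw [map_smul, map_smul, hx]) (fun m m' k a b => ?_) x
  have h : star (s m) * (u a * e k * u b) * s m' =
      star (s m) * u a * e k * u (-(-b)) * s m' := by
    rw [neg_neg]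
    simp only [mul_assoc]
  have hk : e k ∈ projSet R := by rw [← proj_zero]; exact proj_mem k 0
  rw [h]
  exact Subtype.ext ((hΘ m m' a (-b) (e k) hk).trans (hΨ m m' a (-b) (e k) hk).symm)

theorem isDoubleAverage_expectation (hR : ¬ IsField R) :
    IsDoubleAverage (expectation hR) (mulAction R) (addAction hR) :=
  fun x => ⟨mulAvgCore R x, rfl, rfl⟩

end Properties

end RingCStar

end

/-! ### The main theorem -/

theorem mainTheorem2 (R : Type*) [CommRing R] [IsDomain R] (hfield : ¬ IsField R)
    (hfin : ∀ m : R, m ≠ 0 → Finite (R ⧸ Ideal.span {m})) :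
    (∀ x ∈ RingCStar.diagAlg R, ∀ y ∈ RingCStar.diagAlg R, x * y = y * x) ∧
    ∃ Θ : RingCStar.Alg R →L[ℂ] RingCStar.diagAlg R,
      RingCStar.IsCondExp (RingCStar.diagAlg R) Θ ∧
      RingCStar.IsFaithful Θ ∧
      RingCStar.StandardFormula Θ ∧
      (∀ Ψ : RingCStar.Alg R →L[ℂ] RingCStar.diagAlg R, RingCStar.StandardFormula Ψ → Ψ = Θ) ∧
      ∃ (α : RingCStar.Dual (FractionRing R)ˣ →* (RingCStar.Alg R ≃⋆ₐ[ℂ] RingCStar.Alg R))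
        (β : RingCStar.Dual (Multiplicative R) →*
          (RingCStar.coreAlg R ≃⋆ₐ[ℂ] RingCStar.coreAlg R)),
        RingCStar.IsMulDualAction α ∧ RingCStar.IsAddDualAction β ∧
        RingCStar.IsDoubleAverage Θ α β := by
  have : RingCStar.HasFiniteQuotients R := ⟨hfin⟩
  exact ⟨RingCStar.diagAlg_mul_comm, RingCStar.expectation hfield,
    RingCStar.isCondExp_expectation hfield, RingCStar.isFaithful_expectation hfield,
    RingCStar.standardFormula_expectation hfield,
    fun _ hΨ => hΨ.ext (RingCStar.standardFormula_expectation hfield),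
    RingCStar.mulAction R, RingCStar.addAction hfield, RingCStar.isMulDualAction_mulAction,
    RingCStar.isAddDualAction_addAction hfield, RingCStar.isDoubleAverage_expectation hfield⟩
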